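/- Let $I=[0,1)$ and let $f:I^2\to\mathbb R$ be a Lebesgue measurable function. For $n\ge 1$ put $$v_1^\#(f,n)=\sup\sum_{i=1}^n|f(b_i,y_i)-f(a_i,y_i)|,\qquad v_2^\#(f,n)=\sup\sum_{i=1}^n|f(y_i,b_i)-f(y_i,a_i)|,$$ where both suprema (with values in $[0,\infty]$) are taken over all points $y_1,\dots,y_n\in I$ and all collections of $n$ pairwise nonoverlapping intervals $(a_i,b_i)$, $a_i<b_i$, with endpoints in $I$, numbered in an arbitrary order. Suppose that $$\sum_{n=1}^\infty\frac{v_s^\#(f,n)\,\log(n+1)}{n^2}<\infty,\qquad s=1,2.$$ Then $f$ is integrable on $I^2$, and its double Walsh–Fourier series converges to $f(x,y)$ at every point $(x,y)\in I^2$ at which $f$ is continuous, i.e. $$\lim_{M,N\to\infty}\ \sum_{m=0}^{M-1}\sum_{n=0}^{N-1}\hat f(m,n)\,w_m(x)\,w_n(y)=f(x,y),\qquad \hat f(m,n)=\int_{I^2}f(s,t)\,w_m(s)\,w_n(t)\,ds\,dt,$$ where $M,N\to\infty$ independently of each other. Here $w_0=1$ and $w_k=r_{n_1}\cdots r_{n_s}$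 for $k=2^{n_1}+\dots+2^{n_s}$ with $n_1>\dots>n_s\ge 0$ (Walsh functions in the Paley order), where $r_n(x)=r_0(2^nx)$ and $r_0$ is the $1$-periodic function equal to $1$ on $[0,1/2)$ and to $-1$ on $[1/2,1)$. Continuity at $(x,y)$ is understood in the dyadic sense, which is weaker than ordinary continuity: $$f(x\dotplus h,\,y\dotplus\delta)\to f(x,y)\quad\text{as } h,\delta\to 0,\ h,\delta\in I,$$ where $x\dotplus h=\sum_{k=0}^\infty|x_k-h_k|2^{-(k+1)}$ and $x_k,h_k\in\{0,1\}$ are the binary digits of $x=\sum_k x_k2^{-(k+1)}$ and $h=\sum_k h_k2^{-(k+1)}$, a dyadic rational being given its terminating expansion. -/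

import Mathlib

open scoped ENNReal Topology
open MeasureTheory

noncomputable section

namespace WalshFourier

/-- The half-open unit interval `I = [0, 1)`. -/
def unitI : Set ℝ := Set.Ico 0 1

/-- The half-open unit square `I² = [0, 1) × [0, 1)`. -/
def unitSq : Set (ℝ × ℝ) := unitI ×ˢ unitI

/-- `(a i, b i)`, `i < n`, are `n` nonoverlapping (nondegenerate) intervals with endpoints in `I`,
listed in an arbitrary order. -/
def IsNonoverlapping {n : ℕ} (a b : Fin n → ℝ) : Prop :=
  (∀ i, a i ∈ unitI ∧ b i ∈ unitI ∧ a i < b i) ∧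
    Pairwise fun i j => Disjoint (Set.Ioo (a i) (b i)) (Set.Ioo (a j) (b j))

/-- `v₁^#(n, f)`: the supremum, over `n` nonoverlapping intervals `(a i, b i)` of `I` and `n`
points `y i` of `I`, of `∑ i, |f (b i, y i) - f (a i, y i)|` (possibly infinite). -/
def vSharpOne (f : ℝ → ℝ → ℝ) (n : ℕ) : ℝ≥0∞ :=
  ⨆ (y : Fin n → ℝ) (_ : ∀ i, y i ∈ unitI) (a : Fin n → ℝ) (b : Fin n → ℝ)
    (_ : IsNonoverlapping a b), ∑ i, ENNReal.ofReal |f (b i) (y i) - f (a i) (y i)|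

/-- `v₂^#(n, f)`: the supremum, over `n` points `x j` of `I` and `n` nonoverlapping intervals
`(c j, d j)` of `I`, of `∑ j, |f (x j, d j) - f (x j, c j)|` (possibly infinite). -/
def vSharpTwo (f : ℝ → ℝ → ℝ) (n : ℕ) : ℝ≥0∞ :=
  ⨆ (x : Fin n → ℝ) (_ : ∀ j, x j ∈ unitI) (c : Fin n → ℝ) (d : Fin n → ℝ)
    (_ : IsNonoverlapping c d), ∑ j, ENNReal.ofReal |f (x j) (d j) - f (x j) (c j)|

/-- The 1-periodic function equal to `1` on `[0, 1/2)` and to `-1` on `[1/2, 1)`. -/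
def rademacherZero (x : ℝ) : ℝ := if Int.fract x < 1 / 2 then 1 else -1

/-- The Rademacher functions `r_n(x) = r_0(2^n x)`. -/
def rademacher (n : ℕ) (x : ℝ) : ℝ := rademacherZero (2 ^ n * x)

/-- The Walsh functions in the Paley enumeration: `w_k` is the product of the `r_i` over the
positions `i` of the binary digits `1` of `k`; in particular `w_0 = 1`. -/
def walsh (k : ℕ) (x : ℝ) : ℝ := ∏ i ∈ k.bitIndices.toFinset, rademacher i x

/-- The double Walsh–Fourier coefficient of `f`. -/
def walshCoeff (f : ℝ → ℝ → ℝ) (m n : ℕ) : ℝ :=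
  ∫ p in unitSq, f p.1 p.2 * walsh m p.1 * walsh n p.2

/-- The rectangular partial sum `S_{M,N}(x, y; f)` of the double Walsh–Fourier series. -/
def walshPartialSum (f : ℝ → ℝ → ℝ) (M N : ℕ) (x y : ℝ) : ℝ :=
  ∑ m ∈ Finset.range M, ∑ n ∈ Finset.range N, walshCoeff f m n * walsh m x * walsh n y

/-- The dyadic sum `∑ k, |x_k - y_k| 2^{-(k+1)}`, where `x_k`, `y_k` are the binary digits of
`x, y ∈ [0, 1)` (for dyadic rationals, those of the terminating expansion). -/
def dyadicAdd (x y : ℝ) : ℝ :=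
  ∑' k : ℕ, |((Real.digits x 2 k : ℕ) : ℝ) - ((Real.digits y 2 k : ℕ) : ℝ)| * (2⁻¹ : ℝ) ^ (k + 1)

/-- Continuity of `f` at `(x, y)` in the dyadic sense: `f (x ∔ h, y ∔ δ) → f (x, y)` as
`h, δ → 0` in `I`. -/
def DyadicContinuousAt (f : ℝ → ℝ → ℝ) (x y : ℝ) : Prop :=
  Filter.Tendsto (fun p : ℝ × ℝ => f (dyadicAdd x p.1) (dyadicAdd y p.2))
    (𝓝[unitSq] (0, 0)) (𝓝 (f x y))

end WalshFourier

end

namespace WalshFourier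

/-! For `M < 2 ^ A` the Dirichlet kernel splits as `D_{2^A+M}(x,s) = D_{2^A}(x,s) + r_A(x) r_A(s)
D_M(x,s)`. The first term lives on the level-`A` dyadic interval of `x`. In the second, `D_M` is
constant on level-`A` intervals while `r_A` changes sign between their halves. On a shifted grid of
step `2^{-(A+1)}` the operator therefore sees two central values plus differences of `f` across
sibling halves, with weights at most `2/(ρ+1)`, where `ρ` is the xor of the interval's index with
that of `x` (`exists_kernel_weights`). The true partial sum is the integral of the grid sums over
the shifts (`walshPartialSum_eq_integral_grid`), so a uniform bound for almost every shift suffices.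

In two variables this gives four central values, single differences and mixed differences weighted
by `1/((ρ+1)(σ+1))`, up to a constant. For indices below a fixed `K` all points are dyadically close
to `(x, y)`, and continuity applies. Otherwise the difference is bounded by increments in the
variable with the larger index; summing the reciprocal over the smaller index costs the logarithm
(`abs_sum_sum_weight_le`). Since `v^#` lets the height vary with the interval, the largest
increments over all grid heights still have `n`-term sums at most `v^#(n)`
(`exists_increment_majorant`). Summation by parts then bounds the far part by a tail of the
hypothesis series (`sum_harmonicWeight_le`). Thus `K` is chosen from the tails, next the
neighbourhood of `(x, y)`, and last the size of the partial sums.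

Integrability is easier: finiteness of `v^#(1)` in both variables makes `f` bounded on the square.
-/

/-! ### Dyadic cells, Rademacher and Walsh functions -/

/-- The index of the dyadic interval of length `2 ^ (-p)` that contains `x`. -/
noncomputable def cell (p : ℕ) (x : ℝ) : ℕ := ⌊(2 : ℝ) ^ p * x⌋₊

/-- The Walsh–Dirichlet kernel `∑ m < M, w_m(x) w_m(s)`. -/
noncomputable def walshKernel (M : ℕ) (x s : ℝ) : ℝ :=
  ∑ m ∈ Finset.range M, walsh m x * walsh m s

lemma cell_div (p k : ℕ) (x : ℝ) : cell (p + k) x / 2 ^ k = cell p x := by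
  have h := Nat.floor_div_natCast ((2 : ℝ) ^ (p + k) * x) (2 ^ k)
  rw [cell, cell, ← h]
  congr 1
  push_cast
  rw [pow_add]
  field_simp

lemma cell_zero {x : ℝ} (hx : x ∈ unitI) : cell 0 x = 0 := by
  simp [cell, Nat.floor_eq_zero, hx.2]

lemma cell_lt {x : ℝ} (hx : x ∈ unitI) (p : ℕ) : cell p x < 2 ^ p := by
  have h := cell_div 0 p x
  rw [cell_zero hx, zero_add] at h
  exact (Nat.div_eq_zero_iff_lt (by positivity)).1 h

lemma cell_eq_of_le {x s : ℝ} {p q : ℕ} (hpq : p ≤ q) (h : cell q x = cell q s) :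
    cell p x = cell p s := by
  obtain ⟨k, rfl⟩ := Nat.exists_eq_add_of_le hpq
  rw [← cell_div p k x, ← cell_div p k s, h]

lemma cell_grid {a i : ℕ} {u : ℝ} (hu : u ∈ Set.Ico (0 : ℝ) ((2 ^ a)⁻¹)) :
    cell a ((i : ℝ) / 2 ^ a + u) = i := by
  have h2 : (0 : ℝ) < 2 ^ a := by positivity
  have h : (2 : ℝ) ^ a * ((i : ℝ) / 2 ^ a + u) = 2 ^ a * u + i := by field_simp; ring
  rw [cell, h, Nat.floor_add_natCast (mul_nonneg h2.le hu.1), Nat.floor_eq_zero.2, zero_add]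
  have := mul_lt_mul_of_pos_left hu.2 h2
  rwa [mul_inv_cancel₀ h2.ne'] at this

lemma grid_mem_unitI {a i : ℕ} (hi : i < 2 ^ a) {u : ℝ} (hu : u ∈ Set.Ico (0 : ℝ) ((2 ^ a)⁻¹)) :
    (i : ℝ) / 2 ^ a + u ∈ unitI := by
  have h2 : (0 : ℝ) < 2 ^ a := by positivity
  refine ⟨add_nonneg (by positivity) hu.1, ?_⟩
  have h1 : ((i : ℝ) + 1) / 2 ^ a ≤ 1 := by
    rw [div_le_one h2]; exact_mod_cast hi
  have := hu.2
  rw [add_div, one_div] at h1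
  linarith

lemma rademacher_eq (n : ℕ) {x : ℝ} (hx : 0 ≤ x) :
    rademacher n x = if cell (n + 1) x % 2 = 0 then 1 else -1 := by
  rw [rademacher, rademacherZero]
  set y := (2 : ℝ) ^ n * x with hy
  have hy0 : 0 ≤ y := by positivity
  have hc : cell (n + 1) x = ⌊2 * y⌋₊ := by rw [cell, hy, pow_succ']; ring_nf
  have hfr : Int.fract y = y - ⌊y⌋₊ := by
    rw [Int.fract, natCast_floor_eq_intCast_floor hy0]
  have h1 := Nat.floor_le hy0
  have h2 := Nat.lt_floor_add_one y
  rw [hc, hfr]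
  by_cases h : y - ⌊y⌋₊ < 1 / 2
  · have : ⌊2 * y⌋₊ = 2 * ⌊y⌋₊ := by
      rw [Nat.floor_eq_iff (by positivity)]
      push_cast
      constructor <;> linarith
    rw [if_pos h, if_pos (by omega)]
  · have : ⌊2 * y⌋₊ = 2 * ⌊y⌋₊ + 1 := by
      rw [Nat.floor_eq_iff (by positivity)]
      push_cast
      constructor <;> linarith
    rw [if_neg h, if_neg (by omega)]

lemma rademacher_mul_self (n : ℕ) (x : ℝ) : rademacher n x * rademacher n x = 1 := by
  unfold rademacher rademacherZero
  split_ifs <;> norm_num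

lemma abs_rademacher (n : ℕ) (x : ℝ) : |rademacher n x| = 1 := by
  unfold rademacher rademacherZero
  split_ifs <;> norm_num

lemma abs_walsh (k : ℕ) (x : ℝ) : |walsh k x| = 1 := by
  simp [walsh, Finset.abs_prod, abs_rademacher]

/-- Adding `2 ^ A` to `m < 2 ^ A` only switches on the binary digit `A`; this is where the Paley
order enters. -/
lemma walsh_two_pow_add {A m : ℕ} (hm : m < 2 ^ A) (x : ℝ) :
    walsh (2 ^ A + m) x = rademacher A x * walsh m x := by
  have h : (2 ^ A + m).bitIndices.toFinset = insert A m.bitIndices.toFinset := by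
    ext i
    simp only [List.mem_toFinset, Nat.mem_bitIndices, Finset.mem_insert]
    rcases lt_trichotomy i A with h | h | h
    · rw [Nat.testBit_two_pow_add_gt h]
      simp [h.ne]
    · subst h
      simp [Nat.testBit_two_pow_add_eq, Nat.testBit_lt_two_pow hm]
    · have h1 : m < 2 ^ i := hm.trans (Nat.pow_lt_pow_right (by norm_num) h)
      have h2 : 2 ^ A + m < 2 ^ i := by
        have := Nat.pow_le_pow_right (n := 2) (by norm_num) h
        rw [Nat.succ_eq_add_one, pow_succ] at this
        omega
      simp [Nat.testBit_lt_two_pow h1, Nat.testBit_lt_two_pow h2, h.ne']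
  have hA : A ∉ m.bitIndices.toFinset := by
    simp [Nat.mem_bitIndices, Nat.testBit_lt_two_pow hm]
  rw [walsh, h, Finset.prod_insert hA, walsh]

lemma rademacher_congr {n p : ℕ} (hn : n < p) {s s' : ℝ} (hs : 0 ≤ s) (hs' : 0 ≤ s')
    (h : cell p s = cell p s') : rademacher n s = rademacher n s' := by
  rw [rademacher_eq n hs, rademacher_eq n hs', cell_eq_of_le hn h]

lemma walsh_congr {m p : ℕ} (hm : m < 2 ^ p) {s s' : ℝ} (hs : 0 ≤ s) (hs' : 0 ≤ s')
    (h : cell p s = cell p s') : walsh m s = walsh m s' := by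
  refine Finset.prod_congr rfl fun i hi => rademacher_congr ?_ hs hs' h
  rw [List.mem_toFinset, Nat.mem_bitIndices] at hi
  by_contra hip
  rw [Nat.testBit_lt_two_pow (hm.trans_le (Nat.pow_le_pow_right (by norm_num) (not_lt.1 hip)))] at hi
  exact absurd hi (by simp)

/-! ### The Walsh–Dirichlet kernel -/

lemma walshKernel_congr {M p : ℕ} (hM : M ≤ 2 ^ p) (x : ℝ) {s s' : ℝ} (hs : 0 ≤ s) (hs' : 0 ≤ s')
    (h : cell p s = cell p s') : walshKernel M x s = walshKernel M x s' :=
  Finset.sum_congr rfl fun m hm => by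
    rw [walsh_congr ((Finset.mem_range.1 hm).trans_le hM) hs hs' h]

lemma walshKernel_two_pow_add {A M : ℕ} (hM : M ≤ 2 ^ A) (x s : ℝ) :
    walshKernel (2 ^ A + M) x s =
      walshKernel (2 ^ A) x s + rademacher A x * rademacher A s * walshKernel M x s := by
  rw [walshKernel, Finset.sum_range_add, walshKernel, walshKernel, Finset.mul_sum]
  congr 1
  refine Finset.sum_congr rfl fun m hm => ?_
  have := (Finset.mem_range.1 hm).trans_le hM
  rw [walsh_two_pow_add this, walsh_two_pow_add this]
  ring

lemma walshKernel_two_pow_succ (A : ℕ) (x s : ℝ) :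
    walshKernel (2 ^ (A + 1)) x s =
      walshKernel (2 ^ A) x s * (1 + rademacher A x * rademacher A s) := by
  rw [pow_succ, mul_two, walshKernel_two_pow_add le_rfl]
  ring

lemma walshKernel_one (x s : ℝ) : walshKernel 1 x s = 1 := by
  simp [walshKernel, walsh]

lemma walshKernel_two_pow_of_eq {A : ℕ} {x s : ℝ} (hx : 0 ≤ x) (hs : 0 ≤ s)
    (h : cell A x = cell A s) : walshKernel (2 ^ A) x s = 2 ^ A := by
  induction A with
  | zero => simp [walshKernel_one]
  | succ A ih =>
    rw [walshKernel_two_pow_succ, ih (cell_eq_of_le A.le_succ h),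
      rademacher_congr A.lt_succ_self hx hs h, rademacher_mul_self]
    ring

/-- At the first level where the cells of `x` and `s` separate, the Rademacher signs are opposite,
so one factor `1 + r(x) r(s)` of the kernel is zero. -/
lemma walshKernel_two_pow_of_ne {A : ℕ} {x s : ℝ} (hx : x ∈ unitI) (hs : s ∈ unitI)
    (h : cell A x ≠ cell A s) : walshKernel (2 ^ A) x s = 0 := by
  induction A with
  | zero => simp [cell_zero hx, cell_zero hs] at h
  | succ A ih =>
    rw [walshKernel_two_pow_succ]
    by_cases hA : cell A x = cell A s
    · rw [← cell_div A 1 x, ← cell_div A 1 s] at hA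
      have : 1 + rademacher A x * rademacher A s = 0 := by
        rw [rademacher_eq A hx.1, rademacher_eq A hs.1]
        rcases Nat.mod_two_eq_zero_or_one (cell (A + 1) x) with h1 | h1 <;>
        rcases Nat.mod_two_eq_zero_or_one (cell (A + 1) s) with h2 | h2 <;>
        first
          | (exfalso; omega)
          | simp [h1, h2]
      rw [this, mul_zero]
    · rw [ih hA, zero_mul]

lemma abs_walshKernel_le (M : ℕ) (x s : ℝ) : |walshKernel M x s| ≤ M := by
  refine (Finset.abs_sum_le_sum_abs _ _).trans ?_
  simp [abs_mul, abs_walsh]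

lemma exists_two_pow_add {M : ℕ} (hM : 0 < M) : ∃ A M', M = 2 ^ A + M' ∧ M' < 2 ^ A := by
  refine ⟨Nat.log 2 M, M - 2 ^ Nat.log 2 M, ?_, ?_⟩
  · have := Nat.pow_log_le_self 2 hM.ne'
    omega
  · have := Nat.lt_pow_succ_log_self (b := 2) (by norm_num) M
    rw [Nat.succ_eq_add_one, pow_succ] at this
    omega

/-- Peel off the leading binary digit of `M`: as long as it is at least `2 ^ p`, the block `D_{2^A}`
vanishes and the remainder is only multiplied by a sign. What is left has fewer than `2 ^ p` terms
of modulus one. -/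
lemma abs_walshKernel_le_two_pow {p : ℕ} {x s : ℝ} (hx : x ∈ unitI) (hs : s ∈ unitI)
    (h : cell p x ≠ cell p s) (M : ℕ) : |walshKernel M x s| ≤ 2 ^ p := by
  induction M using Nat.strong_induction_on with
  | _ M ih =>
    by_cases hM : M < 2 ^ p
    · exact (abs_walshKernel_le M x s).trans (by exact_mod_cast hM.le)
    · have hM0 : 0 < M := (Nat.two_pow_pos p).trans_le (not_lt.1 hM)
      obtain ⟨A, M', rfl, hM'⟩ := exists_two_pow_add hM0
      have hpA : p ≤ A := by
        by_contra hlt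
        have := Nat.pow_le_pow_right (n := 2) (by norm_num) (not_le.1 hlt)
        rw [Nat.succ_eq_add_one, pow_succ] at this
        omega
      rw [walshKernel_two_pow_add hM'.le,
        walshKernel_two_pow_of_ne hx hs fun h' => h (cell_eq_of_le hpA h'), zero_add, abs_mul,
        abs_mul, abs_rademacher, abs_rademacher, one_mul, one_mul]
      exact ih M' (by have := Nat.two_pow_pos A; omega)

/-- Decay of the Walsh–Dirichlet kernel in the dyadic distance. -/
lemma abs_walshKernel_le_div {A M : ℕ} (hM : M ≤ 2 ^ A) {x s : ℝ} (hx : x ∈ unitI)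
    (hs : s ∈ unitI) {ρ : ℕ} (hρ : ρ < 2 ^ A) (h : cell A s = ρ ^^^ cell A x) :
    |walshKernel M x s| ≤ 2 ^ A * (2 / (ρ + 1)) := by
  rcases Nat.eq_zero_or_pos ρ with rfl | hρ0
  · refine (abs_walshKernel_le M x s).trans ?_
    have : (M : ℝ) ≤ 2 ^ A := by exact_mod_cast hM
    norm_num
    linarith [pow_pos (two_pos (α := ℝ)) A]
  -- The leading digit of `ρ` sits at place `l`, so the cells of `x` and `s` already differ at level
  -- `A - l`, which bounds the kernel by `2 ^ (A - l)`.
  · set l := Nat.log 2 ρ with hl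
    have h1 : 2 ^ l ≤ ρ := Nat.pow_log_le_self 2 hρ0.ne'
    have h2 : ρ < 2 ^ (l + 1) := Nat.lt_pow_succ_log_self (by norm_num) ρ
    have hlA : l < A := (Nat.pow_lt_pow_iff_right (by norm_num : 1 < 2)).1 (h1.trans_lt hρ)
    obtain ⟨p, rfl⟩ := Nat.exists_eq_add_of_le' hlA.le
    have hne : cell p x ≠ cell p s := by
      rw [← cell_div p l x, ← cell_div p l s, h, Nat.xor_div_two_pow]
      have h3 : ρ / 2 ^ l ≠ 0 := (Nat.div_pos h1 (by positivity)).ne'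
      intro h4
      apply h3
      have h5 := congrArg (· ^^^ (cell (p + l) x / 2 ^ l)) h4
      simp only [Nat.xor_self, Nat.xor_assoc, Nat.xor_zero] at h5
      exact h5.symm
    refine (abs_walshKernel_le_two_pow hx hs hne M).trans ?_
    have h6 : (ρ : ℝ) + 1 ≤ 2 ^ (l + 1) := by exact_mod_cast h2
    rw [← mul_div_assoc, le_div_iff₀ (by positivity)]
    calc (2 : ℝ) ^ p * (ρ + 1) ≤ 2 ^ p * 2 ^ (l + 1) := by gcongr
      _ = 2 ^ (p + l) * 2 := by ring

lemma sum_range_two_mul (n : ℕ) (φ : ℕ → ℝ) :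
    ∑ i ∈ Finset.range (2 * n), φ i = ∑ i ∈ Finset.range n, (φ (2 * i) + φ (2 * i + 1)) := by
  induction n with
  | zero => simp
  | succ n ih => rw [Nat.mul_succ, Finset.sum_range_succ, Finset.sum_range_succ, ih,
      Finset.sum_range_succ]; ring

lemma sum_range_xor {A c : ℕ} (hc : c < 2 ^ A) (φ : ℕ → ℝ) :
    ∑ i ∈ Finset.range (2 ^ A), φ i = ∑ ρ ∈ Finset.range (2 ^ A), φ (ρ ^^^ c) := by
  refine Finset.sum_nbij' (fun i => i ^^^ c) (fun i => i ^^^ c) ?_ ?_ ?_ ?_ ?_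
  · intro i hi
    exact Finset.mem_range.2 (Nat.xor_lt_two_pow (Finset.mem_range.1 hi) hc)
  · intro i hi
    exact Finset.mem_range.2 (Nat.xor_lt_two_pow (Finset.mem_range.1 hi) hc)
  all_goals intro i _; simp

/-- The discretised partial sum operator: the block of the point itself, plus a combination
of differences over sibling dyadic intervals, with weights decaying in the dyadic distance. -/
lemma exists_kernel_weights {A M : ℕ} (hM : M < 2 ^ A) {x : ℝ} (hx : x ∈ unitI) :
    ∃ e : ℕ → ℝ, (∀ ρ < 2 ^ A, |e ρ| ≤ 2 / (ρ + 1)) ∧ ∀ h : ℕ → ℝ,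
      ∑ i ∈ Finset.range (2 ^ (A + 1)),
          walshKernel (2 ^ A + M) x ((i : ℝ) / 2 ^ (A + 1)) * h i =
        2 ^ A * (h (2 * cell A x) + h (2 * cell A x + 1) +
          ∑ ρ ∈ Finset.range (2 ^ A),
            e ρ * (h (2 * (ρ ^^^ cell A x)) - h (2 * (ρ ^^^ cell A x) + 1))) := by
  set c := cell A x with hc
  have hcA : c < 2 ^ A := cell_lt hx A
  let g : ℕ → ℝ := fun i => ((i : ℕ) : ℝ) / 2 ^ (A + 1)
  have hg0 : ∀ i, 0 ≤ g i := fun i => by positivity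
  have hu : (0 : ℝ) ∈ Set.Ico (0 : ℝ) ((2 ^ (A + 1))⁻¹) := ⟨le_rfl, by positivity⟩
  have hgc : ∀ i, cell (A + 1) (g i) = i := fun i => by
    have := cell_grid (a := A + 1) (i := i) hu
    rwa [add_zero] at this
  have hgI : ∀ i < 2 ^ (A + 1), g i ∈ unitI := fun i hi => by
    have := grid_mem_unitI (a := A + 1) hi hu
    rwa [add_zero] at this
  have hgA : ∀ i, cell A (g i) = i / 2 := fun i => by
    rw [← cell_div A 1, hgc, pow_one]
  have hr : ∀ i, rademacher A (g i) = if i % 2 = 0 then 1 else -1 := fun i => by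
    rw [rademacher_eq A (hg0 i), hgc]
  have hpow : (2 : ℝ) ^ A ≠ 0 := by positivity
  -- The left endpoint of the interval represents it, since the kernel of order `M` is constant
  -- there; dividing by `2 ^ A` normalises the weight.
  refine ⟨fun ρ => rademacher A x * walshKernel M x (g (2 * (ρ ^^^ c))) / 2 ^ A, ?_, ?_⟩
  · intro ρ hρ
    have hlt : ρ ^^^ c < 2 ^ A := Nat.xor_lt_two_pow hρ hcA
    rw [abs_div, abs_mul, abs_rademacher, one_mul, abs_of_pos (by positivity : (0 : ℝ) < 2 ^ A),
      div_le_iff₀ (by positivity), mul_comm (2 / _)]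
    refine abs_walshKernel_le_div hM.le hx (hgI _ (by rw [pow_succ']; exact Nat.mul_lt_mul_of_pos_left hlt two_pos)) hρ ?_
    rw [hgA, Nat.mul_div_cancel_left _ two_pos]
  · intro h
    have hK : ∀ i < 2 ^ A, ∀ j, j / 2 = i → walshKernel (2 ^ A + M) x (g j) =
        (if i = c then 2 ^ A else 0) + (if j % 2 = 0 then 1 else -1) *
          (rademacher A x * walshKernel M x (g (2 * i))) := by
      intro i hi j hj
      have hjlt : j < 2 ^ (A + 1) := by rw [pow_succ]; omega
      rw [walshKernel_two_pow_add hM.le, hr,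
        walshKernel_congr hM.le x (hg0 j) (hg0 (2 * i)) (by rw [hgA, hgA]; omega)]
      by_cases hic : i = c
      · rw [if_pos hic, walshKernel_two_pow_of_eq hx.1 (hg0 j) (by rw [hgA, hj, hic])]
        ring
      · rw [if_neg hic, walshKernel_two_pow_of_ne hx (hgI j hjlt)
          (by rw [hgA, hj]; exact fun h' => hic h'.symm)]
        ring
    have hsum : ∑ i ∈ Finset.range (2 ^ (A + 1)),
          walshKernel (2 ^ A + M) x ((i : ℝ) / 2 ^ (A + 1)) * h i =
        ∑ i ∈ Finset.range (2 ^ A), ((if i = c then 2 ^ A * (h (2 * i) + h (2 * i + 1)) else 0) +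
          rademacher A x * walshKernel M x (g (2 * i)) * (h (2 * i) - h (2 * i + 1))) := by
      rw [pow_succ' (2 : ℕ) A, sum_range_two_mul]
      refine Finset.sum_congr rfl fun i hi => ?_
      have hi' := Finset.mem_range.1 hi
      have e1 := hK i hi' (2 * i) (by omega)
      have e2 := hK i hi' (2 * i + 1) (by omega)
      rw [if_pos (by omega : 2 * i % 2 = 0)] at e1
      rw [if_neg (by omega : ¬ (2 * i + 1) % 2 = 0)] at e2
      change walshKernel (2 ^ A + M) x (g (2 * i)) * _ +
        walshKernel (2 ^ A + M) x (g (2 * i + 1)) * _ = _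
      rw [e1, e2]
      split_ifs <;> ring
    rw [hsum, Finset.sum_add_distrib, Finset.sum_ite_eq' (Finset.range (2 ^ A)) c,
      if_pos (Finset.mem_range.2 hcA), sum_range_xor hcA, mul_add (2 ^ A) (h _ + h _), Finset.mul_sum]
    congr 1
    refine Finset.sum_congr rfl fun ρ _ => ?_
    field_simp

/-! ### Dyadic addition and dyadic continuity -/

lemma digits_val (x : ℝ) (k : ℕ) : (Real.digits x 2 k : ℕ) = cell (k + 1) x % 2 := by
  rw [Real.digits, Fin.val_ofNat, cell, mul_comm x]
  norm_num

lemma digits_eq_of_cell_eq {x s : ℝ} {p k : ℕ} (hk : k < p) (h : cell p x = cell p s) :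
    Real.digits x 2 k = Real.digits s 2 k := by
  apply Fin.ext
  rw [digits_val, digits_val, cell_eq_of_le hk h]

lemma ofDigits_two_lt_one {d : ℕ → Fin 2} {k : ℕ} (hk : d k = 0) : Real.ofDigits d < 1 := by
  have h1 : Real.ofDigits (fun _ : ℕ => Fin.last 1) = 1 := Real.ofDigits_const_last_eq_one 1
  rw [← h1]
  refine Summable.tsum_lt_tsum (i := k) (fun n => ?_) ?_ Real.summable_ofDigitsTerm
    Real.summable_ofDigitsTerm
  · unfold Real.ofDigitsTerm
    gcongr
    exact Fin.le_last _
  · unfold Real.ofDigitsTerm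
    rw [hk]
    norm_num

/-- A binary expansion which is not eventually `1` is the terminating one. -/
lemma digits_ofDigits_two {d : ℕ → Fin 2} (hd : ∀ n, ∃ k, n ≤ k ∧ d k = 0) :
    Real.digits (Real.ofDigits d) 2 = d := by
  have key : ∀ k, ∃ N : ℕ, (2 : ℝ) ^ k * ∑ i ∈ Finset.range k, Real.ofDigitsTerm d i = N := by
    intro k
    induction k with
    | zero => exact ⟨0, by simp⟩
    | succ k ih =>
      obtain ⟨N, hN⟩ := ih
      refine ⟨2 * N + d k, ?_⟩
      rw [Finset.sum_range_succ, mul_add, pow_succ', mul_assoc, hN, Real.ofDigitsTerm]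
      push_cast
      field_simp
      ring
  funext k
  apply Fin.ext
  obtain ⟨N, hN⟩ := key k
  have hcell : cell (k + 1) (Real.ofDigits d) = 2 * N + d k := by
    set τ := Real.ofDigits (fun i => d (i + (k + 1))) with hτ
    have hτ0 : 0 ≤ τ := Real.ofDigits_nonneg _
    -- Strictness is what makes the floor exact: a later digit `0` excludes a tail of ones.
    have hτ1 : τ < 1 := by
      obtain ⟨j, hj, hj0⟩ := hd (k + 1)
      refine ofDigits_two_lt_one (k := j - (k + 1)) ?_
      rw [Nat.sub_add_cancel hj, hj0]
    have : (2 : ℝ) ^ (k + 1) * Real.ofDigits d = ((2 * N + d k : ℕ) : ℝ) + τ := by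
      rw [Real.ofDigits_eq_sum_add_ofDigits d (k + 1), Finset.sum_range_succ, ← hτ, mul_add,
        mul_add, pow_succ', mul_assoc, hN, Real.ofDigitsTerm]
      push_cast
      field_simp
      ring
    rw [cell, this, Nat.floor_eq_iff (by positivity)]
    constructor <;> linarith
  rw [digits_val, hcell]
  omega

/-- The digits of `x ∔ s`, before normalisation. -/
noncomputable def digitXor (x s : ℝ) (k : ℕ) : Fin 2 :=
  if Real.digits x 2 k = Real.digits s 2 k then 0 else 1

lemma dyadicAdd_eq_ofDigits (x s : ℝ) : dyadicAdd x s = Real.ofDigits (digitXor x s) := by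
  unfold dyadicAdd Real.ofDigits Real.ofDigitsTerm
  refine tsum_congr fun k => ?_
  rw [digitXor]
  generalize Real.digits x 2 k = a
  generalize Real.digits s 2 k = b
  fin_cases a <;> fin_cases b <;> simp

/-- The points `s` for which the digitwise sum of `x` and `s` is eventually `1`. -/
def exceptional (x : ℝ) : Set ℝ :=
  {s | s ∈ unitI ∧ ∃ n, ∀ k, n ≤ k → Real.digits x 2 k ≠ Real.digits s 2 k}

/-- Once `n` is fixed, all digits of `s` from place `n` on are the complements of those of `x`, so
`s` is determined by its first `n` digits, that is, by its cell of level `n`. -/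
lemma countable_exceptional (x : ℝ) : (exceptional x).Countable := by
  have : exceptional x ⊆ ⋃ n : ℕ,
      {s | s ∈ unitI ∧ ∀ k, n ≤ k → Real.digits x 2 k ≠ Real.digits s 2 k} := by
    rintro s ⟨hs, n, hn⟩
    exact Set.mem_iUnion.2 ⟨n, hs, hn⟩
  refine Set.Countable.mono this (Set.countable_iUnion fun n => ?_)
  refine Set.MapsTo.countable_of_injOn (f := cell n) (Set.mapsTo_univ _ _) ?_ Set.countable_univ
  rintro s ⟨hs, hsn⟩ t ⟨ht, htn⟩ hst
  rw [← Real.ofDigits_digits one_lt_two hs, ← Real.ofDigits_digits one_lt_two ht]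
  congr 1
  funext k
  rcases lt_or_ge k n with hk | hk
  · exact digits_eq_of_cell_eq hk hst
  · have h1 := hsn k hk
    have h2 := htn k hk
    omega

/-- Off the exceptional set the digitwise xor is already a terminating-type expansion, so its digits
can be read back, and xor with `x` is an involution. -/
lemma dyadicAdd_dyadicAdd {x s : ℝ} (hs : s ∈ unitI) (hsx : s ∉ exceptional x) :
    dyadicAdd x (dyadicAdd x s) = s := by
  have hd : ∀ n, ∃ k, n ≤ k ∧ digitXor x s k = 0 := by
    intro n
    by_contra! hcon
    refine hsx ⟨hs, n, fun k hk h => hcon k hk ?_⟩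
    rw [digitXor, if_pos h]
  conv_rhs => rw [← Real.ofDigits_digits one_lt_two hs]
  rw [dyadicAdd_eq_ofDigits]
  congr 1
  funext k
  rw [digitXor, dyadicAdd_eq_ofDigits, digits_ofDigits_two hd, digitXor]
  generalize Real.digits x 2 k = a
  generalize Real.digits s 2 k = b
  fin_cases a <;> fin_cases b <;> simp

lemma dyadicAdd_nonneg (x s : ℝ) : 0 ≤ dyadicAdd x s := by
  rw [dyadicAdd_eq_ofDigits]
  exact Real.ofDigits_nonneg _

lemma dyadicAdd_le_of_cell_eq {x s : ℝ} {p : ℕ} (h : cell p s = cell p x) :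
    dyadicAdd x s ≤ (2 ^ p)⁻¹ := by
  have h0 : Real.ofDigits (fun _ : ℕ => (0 : Fin 2)) = 0 := by
    simp [Real.ofDigits, Real.ofDigitsTerm]
  have := Real.abs_ofDigits_sub_ofDigits_le (x := digitXor x s) (y := fun _ => 0) (n := p)
    fun i hi => if_pos (digits_eq_of_cell_eq hi h.symm)
  rw [h0, sub_zero, ← dyadicAdd_eq_ofDigits] at this
  exact (le_abs_self _).trans (by exact_mod_cast this)

/-- Reaches `s` as `x ∔ h` with `h = x ∔ s`, which is small when `s` shares a fine cell with `x`.
The excluded points, for which this inversion can fail, form null sets. -/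
lemma DyadicContinuousAt.exists_cell {f : ℝ → ℝ → ℝ} {x y : ℝ} (h : DyadicContinuousAt f x y)
    {η : ℝ} (hη : 0 < η) :
    ∃ p, ∀ s ∈ unitI, ∀ t ∈ unitI, s ∉ exceptional x → t ∉ exceptional y →
      cell p s = cell p x → cell p t = cell p y → |f s t - f x y| ≤ η := by
  obtain ⟨δ, hδ, hcont⟩ := Metric.tendsto_nhdsWithin_nhds.1 h η hη
  obtain ⟨p, hp⟩ := exists_pow_lt_of_lt_one (lt_min hδ one_pos) (by norm_num : (2⁻¹ : ℝ) < 1)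
  rw [inv_pow] at hp
  refine ⟨p, fun s hs t ht hsx hty hsp htp => ?_⟩
  have h1 := (dyadicAdd_le_of_cell_eq hsp).trans_lt hp
  have h2 := (dyadicAdd_le_of_cell_eq htp).trans_lt hp
  have := hcont (x := (dyadicAdd x s, dyadicAdd y t))
    ⟨⟨dyadicAdd_nonneg _ _, h1.trans_le (min_le_right _ _)⟩,
      ⟨dyadicAdd_nonneg _ _, h2.trans_le (min_le_right _ _)⟩⟩ (by
      rw [Prod.dist_eq, Real.dist_eq, Real.dist_eq, sub_zero, sub_zero,
        abs_of_nonneg (dyadicAdd_nonneg _ _), abs_of_nonneg (dyadicAdd_nonneg _ _)]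
      exact max_lt (h1.trans_le (min_le_left _ _)) (h2.trans_le (min_le_left _ _)))
  rw [Real.dist_eq, dyadicAdd_dyadicAdd hs hsx, dyadicAdd_dyadicAdd ht hty] at this
  exact this.le

/-! ### Partial sums as integrals over shifts of a dyadic grid -/

lemma measurable_rademacher (n : ℕ) : Measurable (rademacher n) := by
  have h : Measurable rademacherZero :=
    Measurable.ite (measurableSet_lt measurable_fract measurable_const) measurable_const
      measurable_const
  exact h.comp (measurable_const_mul _)

lemma measurable_walsh (k : ℕ) : Measurable (walsh k) :=
  Finset.measurable_fun_prod _ fun i _ => measurable_rademacher i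

lemma measurable_cell (p : ℕ) : Measurable (cell p) :=
  Nat.measurable_floor.comp (measurable_const_mul _)

lemma measurableSet_unitSq : MeasurableSet unitSq := measurableSet_Ico.prod measurableSet_Ico

/-- The dyadic rectangle with corner at the origin and sides `2 ^ (-a)`, `2 ^ (-b)`. -/
def cornerRect (a b : ℕ) : Set (ℝ × ℝ) :=
  Set.Ico (0 : ℝ) ((2 ^ a)⁻¹) ×ˢ Set.Ico (0 : ℝ) ((2 ^ b)⁻¹)

lemma measurableSet_cornerRect (a b : ℕ) : MeasurableSet (cornerRect a b) :=
  measurableSet_Ico.prod measurableSet_Ico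

lemma volume_cornerRect (a b : ℕ) :
    volume (cornerRect a b) = ENNReal.ofReal ((2 ^ a)⁻¹ * (2 ^ b)⁻¹) := by
  rw [cornerRect, Measure.volume_eq_prod, Measure.prod_prod, Real.volume_Ico, Real.volume_Ico,
    sub_zero, sub_zero, ENNReal.ofReal_mul (by positivity)]

lemma sub_mem_of_cell_eq {a i : ℕ} {s : ℝ} (hs : 0 ≤ s) (h : cell a s = i) :
    s - (i : ℝ) / 2 ^ a ∈ Set.Ico (0 : ℝ) ((2 ^ a)⁻¹) := by
  have h2 : (0 : ℝ) < 2 ^ a := by positivity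
  obtain ⟨h3, h4⟩ := (Nat.floor_eq_iff (by positivity)).1 h
  constructor
  · rw [sub_nonneg, div_le_iff₀ h2]
    linarith
  · rw [sub_lt_iff_lt_add, ← one_div, ← add_div, lt_div_iff₀ h2]
    linarith

/-- The dyadic rectangle with indices `i`, `j`. -/
def dyadicRect (a b : ℕ) (q : ℕ × ℕ) : Set (ℝ × ℝ) :=
  unitSq ∩ {p | cell a p.1 = q.1 ∧ cell b p.2 = q.2}

lemma measurableSet_dyadicRect (a b : ℕ) (q : ℕ × ℕ) : MeasurableSet (dyadicRect a b q) :=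
  measurableSet_unitSq.inter
    ((((measurable_cell a).comp measurable_fst) (measurableSet_singleton q.1)).inter
      (((measurable_cell b).comp measurable_snd) (measurableSet_singleton q.2)))

lemma unitSq_eq_iUnion (a b : ℕ) :
    unitSq = ⋃ q ∈ Finset.range (2 ^ a) ×ˢ Finset.range (2 ^ b), dyadicRect a b q := by
  ext p
  simp only [Set.mem_iUnion, exists_prop]
  constructor
  · intro hp
    exact ⟨(cell a p.1, cell b p.2), Finset.mem_product.2
      ⟨Finset.mem_range.2 (cell_lt hp.1 a), Finset.mem_range.2 (cell_lt hp.2 b)⟩, hp, rfl, rfl⟩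
  · rintro ⟨q, -, hp⟩
    exact hp.1

lemma preimage_dyadicRect {a b : ℕ} {q : ℕ × ℕ}
    (hq : q ∈ Finset.range (2 ^ a) ×ˢ Finset.range (2 ^ b)) :
    (fun p => (((q.1 : ℝ) / 2 ^ a, (q.2 : ℝ) / 2 ^ b) : ℝ × ℝ) + p) ⁻¹' dyadicRect a b q =
      cornerRect a b := by
  rw [Finset.mem_product, Finset.mem_range, Finset.mem_range] at hq
  ext p
  constructor
  · rintro ⟨⟨h1, h2⟩, h3, h4⟩
    have h5 := sub_mem_of_cell_eq h1.1 h3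
    have h6 := sub_mem_of_cell_eq h2.1 h4
    simp only [Prod.fst_add, Prod.snd_add, add_sub_cancel_left] at h5 h6
    exact ⟨h5, h6⟩
  · rintro ⟨h1, h2⟩
    exact ⟨⟨grid_mem_unitI hq.1 h1, grid_mem_unitI hq.2 h2⟩, cell_grid h1, cell_grid h2⟩

lemma integrableOn_shift {F : ℝ × ℝ → ℝ} (hF : IntegrableOn F unitSq) {a b : ℕ} {q : ℕ × ℕ}
    (hq : q ∈ Finset.range (2 ^ a) ×ˢ Finset.range (2 ^ b)) :
    IntegrableOn (fun p : ℝ × ℝ => F ((q.1 : ℝ) / 2 ^ a + p.1, (q.2 : ℝ) / 2 ^ b + p.2))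
      (cornerRect a b) := by
  rw [← preimage_dyadicRect hq]
  exact ((measurePreserving_add_left volume _).integrableOn_comp_preimage
    (measurableEmbedding_addLeft _)).2 (hF.mono_set Set.inter_subset_left)

lemma setIntegral_unitSq_eq {F : ℝ × ℝ → ℝ} (hF : IntegrableOn F unitSq) (a b : ℕ) :
    ∫ p in unitSq, F p = ∫ p in cornerRect a b,
      ∑ i ∈ Finset.range (2 ^ a), ∑ j ∈ Finset.range (2 ^ b),
        F ((i : ℝ) / 2 ^ a + p.1, (j : ℝ) / 2 ^ b + p.2) := by
  have h1 : ∫ p in unitSq, F p = ∑ q ∈ Finset.range (2 ^ a) ×ˢ Finset.range (2 ^ b),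
      ∫ p in dyadicRect a b q, F p := by
    conv_lhs => rw [unitSq_eq_iUnion a b]
    refine integral_biUnion_finset _ (fun q _ => measurableSet_dyadicRect a b q) ?_
      fun q _ => hF.mono_set Set.inter_subset_left
    intro q _ q' _ hne
    refine Set.disjoint_left.2 fun p hp hp' => hne ?_
    exact Prod.ext (hp.2.1.symm.trans hp'.2.1) (hp.2.2.symm.trans hp'.2.2)
  simp_rw [← Finset.sum_product']
  rw [h1, integral_finsetSum _ fun q hq => integrableOn_shift hF hq]
  refine Finset.sum_congr rfl fun q hq => ?_
  rw [← preimage_dyadicRect hq]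
  exact ((measurePreserving_add_left volume _).setIntegral_preimage_emb
    (measurableEmbedding_addLeft _) F _).symm

lemma integrableOn_mul_walsh {f : ℝ → ℝ → ℝ}
    (hf : IntegrableOn (fun p : ℝ × ℝ => f p.1 p.2) unitSq) (m n : ℕ) :
    IntegrableOn (fun p : ℝ × ℝ => f p.1 p.2 * walsh m p.1 * walsh n p.2) unitSq := by
  have h1 : Measurable fun p : ℝ × ℝ => walsh m p.1 := (measurable_walsh m).comp measurable_fst
  have h2 : Measurable fun p : ℝ × ℝ => walsh n p.2 := (measurable_walsh n).comp measurable_snd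
  refine (hf.mul_bdd (c := 1) h1.aestronglyMeasurable (.of_forall fun p => ?_)).mul_bdd (c := 1)
    h2.aestronglyMeasurable (.of_forall fun p => ?_)
  all_goals rw [Real.norm_eq_abs, abs_walsh]

lemma mul_walshKernel_eq (f : ℝ → ℝ → ℝ) (M N : ℕ) (x y : ℝ) (p : ℝ × ℝ) :
    walshKernel M x p.1 * walshKernel N y p.2 * f p.1 p.2 =
      ∑ m ∈ Finset.range M, ∑ n ∈ Finset.range N,
        f p.1 p.2 * walsh m p.1 * walsh n p.2 * (walsh m x * walsh n y) := by
  rw [walshKernel, walshKernel, Finset.sum_mul_sum, Finset.sum_mul]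
  refine Finset.sum_congr rfl fun m _ => ?_
  rw [Finset.sum_mul]
  exact Finset.sum_congr rfl fun n _ => by ring

lemma integrableOn_mul_walshKernel {f : ℝ → ℝ → ℝ}
    (hf : IntegrableOn (fun p : ℝ × ℝ => f p.1 p.2) unitSq) (M N : ℕ) (x y : ℝ) :
    IntegrableOn (fun p : ℝ × ℝ => walshKernel M x p.1 * walshKernel N y p.2 * f p.1 p.2)
      unitSq := by
  simp_rw [mul_walshKernel_eq]
  exact integrable_finsetSum _ fun m _ => integrable_finsetSum _ fun n _ =>
    (integrableOn_mul_walsh hf m n).mul_const _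

lemma walshPartialSum_eq_integral {f : ℝ → ℝ → ℝ}
    (hf : IntegrableOn (fun p : ℝ × ℝ => f p.1 p.2) unitSq) (M N : ℕ) (x y : ℝ) :
    walshPartialSum f M N x y =
      ∫ p in unitSq, walshKernel M x p.1 * walshKernel N y p.2 * f p.1 p.2 := by
  simp_rw [mul_walshKernel_eq]
  rw [integral_finsetSum _ fun m _ => integrable_finsetSum _ fun n _ =>
    (integrableOn_mul_walsh hf m n).mul_const _]
  refine Finset.sum_congr rfl fun m _ => ?_
  rw [integral_finsetSum _ fun n _ => (integrableOn_mul_walsh hf m n).mul_const _]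
  refine Finset.sum_congr rfl fun n _ => ?_
  rw [integral_mul_const, walshCoeff, mul_assoc]

/-- The double partial sum as an average of discretised partial sums over shifted dyadic grids. -/
lemma walshPartialSum_eq_integral_grid {f : ℝ → ℝ → ℝ}
    (hf : IntegrableOn (fun p : ℝ × ℝ => f p.1 p.2) unitSq) {M N a b : ℕ} (hM : M ≤ 2 ^ a)
    (hN : N ≤ 2 ^ b) (x y : ℝ) :
    IntegrableOn (fun p : ℝ × ℝ => ∑ i ∈ Finset.range (2 ^ a),
        walshKernel M x ((i : ℝ) / 2 ^ a) * ∑ j ∈ Finset.range (2 ^ b),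
          walshKernel N y ((j : ℝ) / 2 ^ b) * f ((i : ℝ) / 2 ^ a + p.1) ((j : ℝ) / 2 ^ b + p.2))
        (cornerRect a b) ∧
    walshPartialSum f M N x y = ∫ p in cornerRect a b, ∑ i ∈ Finset.range (2 ^ a),
      walshKernel M x ((i : ℝ) / 2 ^ a) * ∑ j ∈ Finset.range (2 ^ b),
        walshKernel N y ((j : ℝ) / 2 ^ b) *
          f ((i : ℝ) / 2 ^ a + p.1) ((j : ℝ) / 2 ^ b + p.2) := by
  -- The kernel does not see the shift, so only `f` depends on the integration variable.
  have hshift : ∀ {M a : ℕ}, M ≤ 2 ^ a → ∀ (x : ℝ) (i : ℕ) {u : ℝ},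
      u ∈ Set.Ico (0 : ℝ) ((2 ^ a)⁻¹) →
      walshKernel M x ((i : ℝ) / 2 ^ a + u) = walshKernel M x ((i : ℝ) / 2 ^ a) := by
    intro M a hM x i u hu
    have h0 : (0 : ℝ) ∈ Set.Ico (0 : ℝ) ((2 ^ a)⁻¹) := ⟨le_rfl, by positivity⟩
    refine walshKernel_congr hM x (add_nonneg (by positivity) hu.1) (by positivity) ?_
    have := cell_grid (i := i) h0
    rw [add_zero] at this
    rw [cell_grid hu, this]
  have hpt : ∀ p ∈ cornerRect a b,
      ∑ i ∈ Finset.range (2 ^ a), ∑ j ∈ Finset.range (2 ^ b),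
        (walshKernel M x ((i : ℝ) / 2 ^ a + p.1) * walshKernel N y ((j : ℝ) / 2 ^ b + p.2) *
          f ((i : ℝ) / 2 ^ a + p.1) ((j : ℝ) / 2 ^ b + p.2)) =
      ∑ i ∈ Finset.range (2 ^ a), walshKernel M x ((i : ℝ) / 2 ^ a) *
        ∑ j ∈ Finset.range (2 ^ b), walshKernel N y ((j : ℝ) / 2 ^ b) *
          f ((i : ℝ) / 2 ^ a + p.1) ((j : ℝ) / 2 ^ b + p.2) := by
    intro p hp
    refine Finset.sum_congr rfl fun i _ => ?_
    rw [Finset.mul_sum]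
    refine Finset.sum_congr rfl fun j _ => ?_
    rw [hshift hM x i hp.1, hshift hN y j hp.2, mul_assoc]
  have hint := integrableOn_mul_walshKernel hf M N x y
  constructor
  · refine IntegrableOn.congr_fun ?_ hpt (measurableSet_cornerRect a b)
    exact integrable_finsetSum _ fun i hi => integrable_finsetSum _ fun j hj =>
      integrableOn_shift (q := (i, j)) hint (Finset.mem_product.2 ⟨hi, hj⟩)
  · rw [walshPartialSum_eq_integral hf, setIntegral_unitSq_eq hint a b]
    exact setIntegral_congr_fun (measurableSet_cornerRect a b) hpt

/-! ### Increments of `f` and the quantity `v^#` -/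

lemma sum_le_vSharpOne (f : ℝ → ℝ → ℝ) {S : Finset ℕ} {a b y : ℕ → ℝ}
    (hy : ∀ i ∈ S, y i ∈ unitI) (hab : ∀ i ∈ S, a i ∈ unitI ∧ b i ∈ unitI ∧ a i < b i)
    (hd : ∀ i ∈ S, ∀ j ∈ S, i ≠ j → Disjoint (Set.Ioo (a i) (b i)) (Set.Ioo (a j) (b j))) :
    ∑ i ∈ S, ENNReal.ofReal |f (b i) (y i) - f (a i) (y i)| ≤ vSharpOne f S.card := by
  let e := S.equivFin
  rw [← Finset.sum_coe_sort S, ← e.symm.sum_comp, vSharpOne]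
  refine le_iSup_of_le (fun k => y (e.symm k)) (le_iSup_of_le (fun k => hy _ (e.symm k).2)
    (le_iSup_of_le (fun k => a (e.symm k)) (le_iSup_of_le (fun k => b (e.symm k))
      (le_iSup_of_le ⟨fun k => hab _ (e.symm k).2, fun k l hkl => ?_⟩ le_rfl))))
  exact hd _ (e.symm k).2 _ (e.symm l).2 fun h => hkl (e.symm.injective (Subtype.ext h))

lemma vSharpOne_le_succ (f : ℝ → ℝ → ℝ) (n : ℕ) : vSharpOne f n ≤ vSharpOne f (n + 1) := by
  conv_lhs => rw [vSharpOne]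
  refine iSup_le fun y => iSup_le fun hy => iSup_le fun a => iSup_le fun b => iSup_le fun hab => ?_
  obtain ⟨c, hc, hbc⟩ : ∃ c ∈ unitI, ∀ i, b i ≤ c := by
    -- An interval `(c, (c+1)/2)` is added to the right of all the others; room remains because
    -- every endpoint is below `1`. Inserting `0` covers the empty family.
    let T : Finset ℝ := insert 0 (Finset.univ.image b)
    have hT : T.Nonempty := Finset.insert_nonempty _ _
    refine ⟨T.max' hT, ?_, fun i => T.le_max' _ (Finset.mem_insert_of_mem
      (Finset.mem_image_of_mem _ (Finset.mem_univ _)))⟩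
    rcases Finset.mem_insert.1 (T.max'_mem hT) with h | h
    · rw [h]
      exact ⟨le_rfl, one_pos⟩
    · obtain ⟨i, -, hi⟩ := Finset.mem_image.1 h
      rw [← hi]
      exact (hab.1 i).2.1
  obtain ⟨hc0, hc1⟩ := hc
  refine le_trans ?_ (le_iSup_of_le (Fin.cons 0 y) (le_iSup_of_le ?_ (le_iSup_of_le (Fin.cons c a)
    (le_iSup_of_le (Fin.cons ((c + 1) / 2) b) (le_iSup_of_le ?_ le_rfl)))))
  · rw [Fin.sum_univ_succ]
    simp
  · intro i
    refine Fin.cases ⟨le_rfl, one_pos⟩ (fun j => ?_) i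
    exact hy j
  · constructor
    · intro i
      refine Fin.cases ⟨⟨hc0, hc1⟩, ⟨?_, ?_⟩, ?_⟩ (fun j => hab.1 j) i <;>
        simp only [Fin.cons_zero] <;> linarith
    · have key : ∀ j, Disjoint (Set.Ioo c ((c + 1) / 2)) (Set.Ioo (a j) (b j)) := fun j =>
        Set.disjoint_left.2 fun z hz hz' => (hz.1.trans (hz'.2.trans_le (hbc j))).false
      intro i j
      refine Fin.cases ?_ (fun i => ?_) i <;> refine Fin.cases ?_ (fun j => ?_) j
      · exact fun h => absurd rfl h
      · exact fun _ => key j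
      · exact fun _ => (key i).symm
      · exact fun h => hab.2 fun h' => h (congrArg _ h')

lemma vSharpOne_mono (f : ℝ → ℝ → ℝ) : Monotone (vSharpOne f) :=
  monotone_nat_of_le_succ (vSharpOne_le_succ f)

lemma ofReal_abs_sub_le_vSharpOne (f : ℝ → ℝ → ℝ) {a b y : ℝ} (ha : a ∈ unitI) (hb : b ∈ unitI)
    (hy : y ∈ unitI) : ENNReal.ofReal |f b y - f a y| ≤ vSharpOne f 1 := by
  have key : ∀ a ∈ unitI, ∀ b ∈ unitI, a < b → ENNReal.ofReal |f b y - f a y| ≤ vSharpOne f 1 := by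
    intro a ha b hb hab
    have := sum_le_vSharpOne f (S := {0}) (a := fun _ => a) (b := fun _ => b) (y := fun _ => y)
      (by simp [hy]) (by simp [ha, hb, hab]) (by simp)
    simpa using this
  rcases lt_trichotomy a b with h | h | h
  · exact key a ha b hb h
  · simp [h]
  · rw [abs_sub_comm]
    exact key b hb a ha h

/-- Over a finite set of heights, the increments along disjoint intervals have a common majorant
whose partial sums are controlled by `v₁^#`. -/
lemma exists_increment_majorant (f : ℝ → ℝ → ℝ) {L : ℕ} {a b : ℕ → ℝ}
    (hab : ∀ i < L, a i ∈ unitI ∧ b i ∈ unitI ∧ a i < b i)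
    (hd : ∀ i < L, ∀ j < L, i ≠ j → Disjoint (Set.Ioo (a i) (b i)) (Set.Ioo (a j) (b j)))
    {T : Finset ℝ} (hT : T.Nonempty) (hTI : ∀ y ∈ T, y ∈ unitI) :
    ∃ m : ℕ → ℝ, (∀ i, 0 ≤ m i) ∧ (∀ i, ∀ y ∈ T, |f (b i) y - f (a i) y| ≤ m i) ∧
      ∀ S ⊆ Finset.range L, ∀ n, S.card ≤ n →
        ∑ i ∈ S, ENNReal.ofReal (m i) ≤ vSharpOne f n := by
  -- The maximising height depends on `i`, which the definition of `v^#` permits; finiteness of `T`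
  -- ensures that the maximum is attained.
  choose y hyT hy using fun i => T.exists_max_image (fun y => |f (b i) y - f (a i) y|) hT
  refine ⟨fun i => |f (b i) (y i) - f (a i) (y i)|, fun i => abs_nonneg _, hy, fun S hS n hn => ?_⟩
  refine (sum_le_vSharpOne f (fun i _ => hTI _ (hyT i))
    (fun i hi => hab i (Finset.mem_range.1 (hS hi))) fun i hi j hj =>
      hd i (Finset.mem_range.1 (hS hi)) j (Finset.mem_range.1 (hS hj))).trans ?_
  exact vSharpOne_mono f hn

/-! ### Logarithmic weights and summation by parts -/

/-- `(1 + 1/2 + ⋯ + 1/(ρ+1)) / (ρ+1)`. -/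
noncomputable def harmonicWeight (ρ : ℕ) : ℝ :=
  (∑ σ ∈ Finset.range (ρ + 1), 1 / ((σ : ℝ) + 1)) / ((ρ : ℝ) + 1)

/-- The weight `log (n + 2) / (n + 1)²` of the summability condition. -/
noncomputable def logWeight (n : ℕ) : ℝ := Real.log ((n : ℝ) + 1 + 1) / ((n : ℝ) + 1) ^ 2

lemma one_div_le_harmonicWeight (ρ : ℕ) : 1 / ((ρ : ℝ) + 1) ≤ harmonicWeight ρ := by
  unfold harmonicWeight
  gcongr
  have := Finset.single_le_sum (f := fun σ : ℕ => 1 / ((σ : ℝ) + 1)) (fun i _ => by positivity)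
    (Finset.mem_range.2 (Nat.succ_pos ρ))
  simpa using this

lemma harmonicWeight_nonneg (ρ : ℕ) : 0 ≤ harmonicWeight ρ :=
  le_trans (by positivity) (one_div_le_harmonicWeight ρ)

lemma harmonicWeight_le (ρ : ℕ) :
    harmonicWeight ρ ≤ 3 * (Real.log ((ρ : ℝ) + 1 + 1) / ((ρ : ℝ) + 1)) := by
  have h1 : ∑ σ ∈ Finset.range (ρ + 1), 1 / ((σ : ℝ) + 1) ≤ 1 + Real.log ((ρ : ℝ) + 1) := by
    have := harmonic_le_one_add_log (ρ + 1)
    rw [harmonic] at this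
    push_cast at this
    simpa using this
  have h2 : Real.log ((ρ : ℝ) + 1) ≤ Real.log ((ρ : ℝ) + 1 + 1) :=
    Real.log_le_log (by positivity) (by linarith)
  have h3 : Real.log 2 ≤ Real.log ((ρ : ℝ) + 1 + 1) :=
    Real.log_le_log two_pos (by linarith [(Nat.cast_nonneg ρ : (0 : ℝ) ≤ ρ)])
  have h4 := Real.log_two_gt_d9
  rw [harmonicWeight, ← mul_div_assoc]
  gcongr
  linarith

lemma logWeight_nonneg (n : ℕ) : 0 ≤ logWeight n :=
  div_nonneg (Real.log_nonneg (by linarith [(Nat.cast_nonneg n : (0 : ℝ) ≤ n)])) (by positivity)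

/-- Telescope `1/(ρ+1)` as the sum over `n ≥ ρ` of `1/(n+1) - 1/(n+2) ≤ 1/(n+1)²`, and increase the
frozen logarithm to its value at `n`. -/
lemma ofReal_log_div_le_tsum (ρ : ℕ) :
    ENNReal.ofReal (Real.log ((ρ : ℝ) + 1 + 1) / ((ρ : ℝ) + 1)) ≤
      ∑' n, if ρ ≤ n then ENNReal.ofReal (logWeight n) else 0 := by
  set l := Real.log ((ρ : ℝ) + 1 + 1) with hl
  have hl0 : 0 ≤ l := Real.log_nonneg (by linarith [(Nat.cast_nonneg ρ : (0 : ℝ) ≤ ρ)])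
  have hstep : ∀ n ≥ ρ, l * (1 / ((n : ℝ) + 1) - 1 / (((n + 1 : ℕ) : ℝ) + 1)) ≤ logWeight n := by
    intro n hn
    have h1 : l ≤ Real.log ((n : ℝ) + 1 + 1) := by
      refine Real.log_le_log (by positivity) ?_
      have : (ρ : ℝ) ≤ n := by exact_mod_cast hn
      linarith
    have h2 : 1 / ((n : ℝ) + 1) - 1 / (((n + 1 : ℕ) : ℝ) + 1) ≤ 1 / ((n : ℝ) + 1) ^ 2 := by
      have : (0 : ℝ) < (n : ℝ) + 1 := by positivity
      push_cast
      rw [div_sub_div _ _ this.ne' (by positivity), div_le_div_iff₀ (by positivity) (by positivity)]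
      nlinarith
    calc _ ≤ l * (1 / ((n : ℝ) + 1) ^ 2) := by gcongr
      _ ≤ Real.log ((n : ℝ) + 1 + 1) * (1 / ((n : ℝ) + 1) ^ 2) := by gcongr
      _ = logWeight n := by rw [logWeight, mul_one_div]
  have hpart : ∀ N, ENNReal.ofReal (l * (1 / ((ρ : ℝ) + 1) - 1 / (((ρ + N : ℕ) : ℝ) + 1))) ≤
      ∑' n, if ρ ≤ n then ENNReal.ofReal (logWeight n) else 0 := by
    intro N
    have htel : l * (1 / ((ρ : ℝ) + 1) - 1 / (((ρ + N : ℕ) : ℝ) + 1)) ≤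
        ∑ n ∈ Finset.Ico ρ (ρ + N), logWeight n := by
      induction N with
      | zero => simp
      | succ N ih =>
        rw [← add_assoc, Finset.sum_Ico_succ_top (by omega)]
        have := hstep (ρ + N) (by omega)
        linarith
    refine (ENNReal.ofReal_le_ofReal htel).trans ?_
    rw [ENNReal.ofReal_sum_of_nonneg fun n _ => logWeight_nonneg n]
    refine le_trans (le_of_eq ?_) (ENNReal.sum_le_tsum (Finset.Ico ρ (ρ + N)))
    exact Finset.sum_congr rfl fun n hn => (if_pos (Finset.mem_Ico.1 hn).1).symm
  refine le_of_tendsto' (x := Filter.atTop) (ENNReal.tendsto_ofReal ?_) hpart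
  have h0 : Filter.Tendsto (fun N : ℕ => 1 / (((ρ + N : ℕ) : ℝ) + 1)) Filter.atTop (𝓝 0) := by
    have := (Filter.tendsto_add_atTop_iff_nat ρ).2 (tendsto_one_div_add_atTop_nhds_zero_nat (𝕜 := ℝ))
    simpa only [add_comm ρ] using this
  have := (h0.const_sub (1 / ((ρ : ℝ) + 1))).const_mul l
  rwa [sub_zero, mul_one_div] at this

/-- Summation by parts: a majorant with partial sums bounded by `V` has small weighted tails. -/
lemma sum_harmonicWeight_le {m : ℕ → ℝ} {V : ℕ → ℝ≥0∞} {L : ℕ} (K : ℕ)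
    (hV : ∀ S ⊆ Finset.range L, ∀ n, S.card ≤ n → ∑ i ∈ S, ENNReal.ofReal (m i) ≤ V n) :
    ∑ ρ ∈ Finset.range L, (if K ≤ ρ then ENNReal.ofReal (harmonicWeight ρ) * ENNReal.ofReal (m ρ)
      else 0) ≤ 3 * ∑' n, V (n + K + 1) * ENNReal.ofReal (logWeight (n + K)) := by
  have h1 : ∀ ρ, ENNReal.ofReal (harmonicWeight ρ) ≤
      3 * ∑' n, if ρ ≤ n then ENNReal.ofReal (logWeight n) else 0 := fun ρ => by
    refine (ENNReal.ofReal_le_ofReal (harmonicWeight_le ρ)).trans ?_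
    rw [ENNReal.ofReal_mul (by norm_num), ENNReal.ofReal_ofNat]
    gcongr
    exact ofReal_log_div_le_tsum ρ
  have h2 : ∑' n, (if K ≤ n then V (n + 1) * ENNReal.ofReal (logWeight n) else 0) =
      ∑' n, V (n + K + 1) * ENNReal.ofReal (logWeight (n + K)) := by
    rw [← ENNReal.summable.sum_add_tsum_nat_add' (k := K), Finset.sum_eq_zero, zero_add]
    · exact tsum_congr fun n => if_pos (Nat.le_add_left _ _)
    · intro n hn
      exact if_neg (not_le.2 (Finset.mem_range.1 hn))
  rw [← h2]
  calc _ ≤ ∑ ρ ∈ Finset.range L, 3 * ∑' n, (if K ≤ ρ ∧ ρ ≤ n then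
          ENNReal.ofReal (logWeight n) * ENNReal.ofReal (m ρ) else 0) := by
        refine Finset.sum_le_sum fun ρ _ => ?_
        by_cases hK : K ≤ ρ
        · rw [if_pos hK]
          refine (mul_le_mul_left (h1 ρ) _).trans (le_of_eq ?_)
          rw [mul_assoc, ← ENNReal.tsum_mul_right]
          congr 1
          refine tsum_congr fun n => ?_
          simp only [hK, true_and, ite_mul, zero_mul]
        · rw [if_neg hK]
          exact zero_le
    _ = 3 * ∑' n, ∑ ρ ∈ Finset.range L, (if K ≤ ρ ∧ ρ ≤ n then
          ENNReal.ofReal (logWeight n) * ENNReal.ofReal (m ρ) else 0) := by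
        rw [← Finset.mul_sum, Summable.tsum_finsetSum fun _ _ => ENNReal.summable]
    _ ≤ _ := by
        gcongr with n
        rw [← Finset.sum_filter, ← Finset.mul_sum, mul_comm]
        by_cases hK : K ≤ n
        · rw [if_pos hK]
          gcongr
          -- After exchanging the sums, the inner one runs over `K ≤ ρ ≤ n`, hence over at most `n +
          -- 1` indices.
          refine hV _ (Finset.filter_subset _ _) _ ?_
          refine (Finset.card_le_card (t := Finset.range (n + 1)) fun ρ hρ => ?_).trans
            (Finset.card_range _).le
          have := (Finset.mem_filter.1 hρ).2.2
          exact Finset.mem_range.2 (by omega)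
        · rw [if_neg hK, Finset.filter_false_of_mem fun ρ _ h => hK (h.1.trans h.2)]
          simp

lemma sum_harmonicWeight_le_of_tail_le {m : ℕ → ℝ} (hm : ∀ i, 0 ≤ m i) {V : ℕ → ℝ≥0∞} {L K : ℕ}
    (hV : ∀ S ⊆ Finset.range L, ∀ n, S.card ≤ n → ∑ i ∈ S, ENNReal.ofReal (m i) ≤ V n)
    {τ : ℝ} (hτ : 0 ≤ τ)
    (htail : 3 * ∑' n, V (n + K + 1) * ENNReal.ofReal (logWeight (n + K)) ≤ ENNReal.ofReal τ) :
    ∑ ρ ∈ Finset.range L, (if K ≤ ρ then harmonicWeight ρ * m ρ else 0) ≤ τ := by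
  rw [← ENNReal.ofReal_le_ofReal_iff hτ, ENNReal.ofReal_sum_of_nonneg]
  · refine le_trans (le_of_eq (Finset.sum_congr rfl fun ρ _ => ?_))
      ((sum_harmonicWeight_le K hV).trans htail)
    split_ifs
    · rw [ENNReal.ofReal_mul (harmonicWeight_nonneg ρ)]
    · exact ENNReal.ofReal_zero
  · intro ρ _
    split_ifs
    · exact mul_nonneg (harmonicWeight_nonneg ρ) (hm ρ)
    · exact le_rfl

/-! ### Weighted sums of single and mixed differences -/

lemma sum_ite_lt_le (L K : ℕ) {c : ℝ} (hc : 0 ≤ c) :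
    ∑ ρ ∈ Finset.range L, (if ρ < K then c else 0) ≤ K * c := by
  rw [← Finset.sum_filter, Finset.sum_const, nsmul_eq_mul]
  gcongr
  refine (Finset.card_le_card (t := Finset.range K) fun ρ hρ => ?_).trans (Finset.card_range K).le
  exact Finset.mem_range.2 (Finset.mem_filter.1 hρ).2

/-- A linear combination of sibling differences with dyadically decaying weights. -/
lemma abs_sum_weight_le {L K : ℕ} {e D m : ℕ → ℝ} {η τ : ℝ} (hη : 0 ≤ η)
    (he : ∀ ρ < L, |e ρ| ≤ 2 / ((ρ : ℝ) + 1))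
    (hnear : ∀ ρ < L, ρ < K → |D ρ| ≤ η) (hD : ∀ ρ < L, |D ρ| ≤ m ρ)
    (hτ : ∑ ρ ∈ Finset.range L, (if K ≤ ρ then harmonicWeight ρ * m ρ else 0) ≤ τ) :
    |∑ ρ ∈ Finset.range L, e ρ * D ρ| ≤ 2 * K * η + 2 * τ := by
  calc |∑ ρ ∈ Finset.range L, e ρ * D ρ| ≤ ∑ ρ ∈ Finset.range L, |e ρ * D ρ| :=
        Finset.abs_sum_le_sum_abs _ _
    _ ≤ ∑ ρ ∈ Finset.range L, ((if ρ < K then 2 * η else 0) +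
          2 * (if K ≤ ρ then harmonicWeight ρ * m ρ else 0)) := by
        refine Finset.sum_le_sum fun ρ hρ => ?_
        have hρL := Finset.mem_range.1 hρ
        rw [abs_mul]
        have h1 := he ρ hρL
        rcases lt_or_ge ρ K with hK | hK
        · rw [if_pos hK, if_neg (not_le.2 hK)]
          have h2 : (2 : ℝ) / ((ρ : ℝ) + 1) ≤ 2 := div_le_self two_pos.le (by simp)
          have := mul_le_mul (h1.trans h2) (hnear ρ hρL hK) (abs_nonneg _) two_pos.le
          linarith
        · rw [if_neg (not_lt.2 hK), if_pos hK]
          have h2 : (2 : ℝ) / ((ρ : ℝ) + 1) ≤ 2 * harmonicWeight ρ := by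
            have := one_div_le_harmonicWeight ρ
            rw [div_eq_mul_one_div]
            linarith
          have := mul_le_mul (h1.trans h2) (hD ρ hρL) (abs_nonneg _)
            (mul_nonneg two_pos.le (harmonicWeight_nonneg ρ))
          linarith
    _ ≤ 2 * K * η + 2 * τ := by
        rw [Finset.sum_add_distrib, ← Finset.mul_sum]
        have := sum_ite_lt_le L K (mul_nonneg two_pos.le hη)
        linarith

/-- Summing over the smaller index produces the harmonic number inside the weight, the source of the
logarithm in the hypothesis. -/
lemma sum_ite_le_harmonicWeight (L' K ρ : ℕ) {m : ℝ} (hm : 0 ≤ m) :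
    ∑ σ ∈ Finset.range L', (if K ≤ ρ ∧ σ ≤ ρ then
      1 / ((ρ : ℝ) + 1) * (1 / ((σ : ℝ) + 1)) * m else 0) ≤
      if K ≤ ρ then harmonicWeight ρ * m else 0 := by
  by_cases hK : K ≤ ρ
  · simp only [hK, true_and, if_true]
    rw [← Finset.sum_filter, ← Finset.sum_mul, ← Finset.mul_sum, harmonicWeight,
      one_div_mul_eq_div]
    have : ∑ σ ∈ Finset.range L' with σ ≤ ρ, 1 / ((σ : ℝ) + 1) ≤
        ∑ σ ∈ Finset.range (ρ + 1), 1 / ((σ : ℝ) + 1) := by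
      refine Finset.sum_le_sum_of_subset_of_nonneg (fun σ hσ => ?_) fun _ _ _ => by positivity
      have := (Finset.mem_filter.1 hσ).2
      exact Finset.mem_range.2 (by omega)
    gcongr
  · simp [hK]

/-- The mixed part of the discretised double partial sum. -/
lemma abs_sum_sum_weight_le {L L' K : ℕ} {e e' : ℕ → ℝ} {D : ℕ → ℕ → ℝ} {m m' : ℕ → ℝ}
    {η τ τ' : ℝ} (hη : 0 ≤ η) (he : ∀ ρ < L, |e ρ| ≤ 2 / ((ρ : ℝ) + 1))
    (he' : ∀ σ < L', |e' σ| ≤ 2 / ((σ : ℝ) + 1)) (hm : ∀ ρ, 0 ≤ m ρ) (hm' : ∀ σ, 0 ≤ m' σ)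
    (hnear : ∀ ρ < L, ρ < K → ∀ σ < L', σ < K → |D ρ σ| ≤ η)
    (hD : ∀ ρ < L, ∀ σ < L', |D ρ σ| ≤ m ρ) (hD' : ∀ ρ < L, ∀ σ < L', |D ρ σ| ≤ m' σ)
    (hτ : ∑ ρ ∈ Finset.range L, (if K ≤ ρ then harmonicWeight ρ * m ρ else 0) ≤ τ)
    (hτ' : ∑ σ ∈ Finset.range L', (if K ≤ σ then harmonicWeight σ * m' σ else 0) ≤ τ') :
    |∑ ρ ∈ Finset.range L, ∑ σ ∈ Finset.range L', e ρ * e' σ * D ρ σ| ≤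
      4 * K ^ 2 * η + 4 * τ + 4 * τ' := by
  let w : ℕ → ℝ := fun n => 1 / ((n : ℝ) + 1)
  have hw0 : ∀ n, 0 ≤ w n := fun n => by positivity
  have hw1 : ∀ n, w n ≤ 1 := fun n => div_le_self one_pos.le (by simp)
  -- Three regions cover the index rectangle: both indices below `K`, or else the larger index at
  -- least `K` and equal to `ρ` or to `σ`. The diagonal may be counted twice.
  let near : ℕ → ℕ → ℝ := fun ρ σ => if ρ < K then (if σ < K then 4 * η else 0) else 0
  let low : ℕ → ℕ → ℝ := fun ρ σ => if K ≤ ρ ∧ σ ≤ ρ then w ρ * w σ * m ρ else 0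
  let high : ℕ → ℕ → ℝ := fun ρ σ => if K ≤ σ ∧ ρ ≤ σ then w σ * w ρ * m' σ else 0
  have hlow0 : ∀ ρ σ, 0 ≤ low ρ σ := fun ρ σ => by
    simp only [low]
    split_ifs
    exacts [mul_nonneg (mul_nonneg (hw0 _) (hw0 _)) (hm _), le_rfl]
  have hhigh0 : ∀ ρ σ, 0 ≤ high ρ σ := fun ρ σ => by
    simp only [high]
    split_ifs
    exacts [mul_nonneg (mul_nonneg (hw0 _) (hw0 _)) (hm' _), le_rfl]
  have hnear0 : ∀ ρ σ, 0 ≤ near ρ σ := fun ρ σ => by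
    simp only [near]
    split_ifs
    exacts [by linarith, le_rfl, le_rfl]
  have hpt : ∀ ρ < L, ∀ σ < L', |e ρ * e' σ * D ρ σ| ≤
      near ρ σ + 4 * low ρ σ + 4 * high ρ σ := by
    intro ρ hρ σ hσ
    have h1 : |e ρ * e' σ| ≤ 4 * (w ρ * w σ) := by
      rw [abs_mul]
      refine (mul_le_mul (he ρ hρ) (he' σ hσ) (abs_nonneg _) (by positivity)).trans (le_of_eq ?_)
      simp only [w]
      ring
    have h10 : 0 ≤ 4 * (w ρ * w σ) := mul_nonneg (by norm_num) (mul_nonneg (hw0 _) (hw0 _))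
    rw [abs_mul]
    by_cases hn : ρ < K ∧ σ < K
    · have h2 : near ρ σ = 4 * η := by simp only [near, hn.1, hn.2, if_true]
      have h3 : 4 * (w ρ * w σ) ≤ 4 := by
        have := mul_le_one₀ (hw1 ρ) (hw0 σ) (hw1 σ)
        linarith
      have := mul_le_mul (h1.trans h3) (hnear ρ hρ hn.1 σ hσ hn.2) (abs_nonneg _) (by norm_num)
      linarith [hlow0 ρ σ, hhigh0 ρ σ]
    · rcases le_total σ ρ with h | h
      · have h2 : low ρ σ = w ρ * w σ * m ρ := if_pos ⟨by omega, h⟩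
        have := mul_le_mul h1 (hD ρ hρ σ hσ) (abs_nonneg _) h10
        linarith [hnear0 ρ σ, hhigh0 ρ σ]
      · have h2 : high ρ σ = w σ * w ρ * m' σ := if_pos ⟨by omega, h⟩
        have := mul_le_mul h1 (hD' ρ hρ σ hσ) (abs_nonneg _) h10
        linarith [hnear0 ρ σ, hlow0 ρ σ]
  have hnear_sum : ∑ ρ ∈ Finset.range L, ∑ σ ∈ Finset.range L', near ρ σ ≤ 4 * K ^ 2 * η := by
    have h1 := sum_ite_lt_le L' K (c := 4 * η) (by linarith)
    calc _ ≤ ∑ ρ ∈ Finset.range L, (if ρ < K then K * (4 * η) else 0) := by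
          refine Finset.sum_le_sum fun ρ _ => ?_
          by_cases hρ : ρ < K
          · simpa only [near, hρ, if_true] using h1
          · simp [near, hρ]
      _ ≤ K * (K * (4 * η)) := sum_ite_lt_le L K (by positivity)
      _ = _ := by ring
  have hlow_sum : ∑ ρ ∈ Finset.range L, ∑ σ ∈ Finset.range L', low ρ σ ≤ τ :=
    (Finset.sum_le_sum fun ρ _ => sum_ite_le_harmonicWeight L' K ρ (hm ρ)).trans hτ
  have hhigh_sum : ∑ ρ ∈ Finset.range L, ∑ σ ∈ Finset.range L', high ρ σ ≤ τ' := by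
    rw [Finset.sum_comm]
    exact (Finset.sum_le_sum fun σ _ => sum_ite_le_harmonicWeight L K σ (hm' σ)).trans hτ'
  calc _ ≤ ∑ ρ ∈ Finset.range L, ∑ σ ∈ Finset.range L', |e ρ * e' σ * D ρ σ| :=
        (Finset.abs_sum_le_sum_abs _ _).trans
          (Finset.sum_le_sum fun _ _ => Finset.abs_sum_le_sum_abs _ _)
    _ ≤ ∑ ρ ∈ Finset.range L, ∑ σ ∈ Finset.range L',
          (near ρ σ + 4 * low ρ σ + 4 * high ρ σ) :=
        Finset.sum_le_sum fun ρ hρ => Finset.sum_le_sum fun σ hσ =>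
          hpt ρ (Finset.mem_range.1 hρ) σ (Finset.mem_range.1 hσ)
    _ ≤ _ := by
        simp only [Finset.sum_add_distrib, ← Finset.mul_sum]
        linarith

/-- The discretised double partial sum of an array `G α β ρ σ`, where `α`, `β` label the
halves of the dyadic intervals at distances `ρ`, `σ`. -/
lemma abs_weighted_array_le {L L' K : ℕ} (hL : 0 < L) (hL' : 0 < L') (hK : 0 < K) {e e' : ℕ → ℝ}
    {G : Bool → Bool → ℕ → ℕ → ℝ} {m m' : ℕ → ℝ} {η τ τ' : ℝ} (hη : 0 ≤ η)
    (he : ∀ ρ < L, |e ρ| ≤ 2 / ((ρ : ℝ) + 1)) (he' : ∀ σ < L', |e' σ| ≤ 2 / ((σ : ℝ) + 1))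
    (hm : ∀ ρ, 0 ≤ m ρ) (hm' : ∀ σ, 0 ≤ m' σ)
    (hnear : ∀ α β, ∀ ρ < L, ρ < K → ∀ σ < L', σ < K → |G α β ρ σ| ≤ η)
    (hG : ∀ β, ∀ ρ < L, ∀ σ < L', |G false β ρ σ - G true β ρ σ| ≤ m ρ)
    (hG' : ∀ α, ∀ ρ < L, ∀ σ < L', |G α false ρ σ - G α true ρ σ| ≤ m' σ)
    (hτ : ∑ ρ ∈ Finset.range L, (if K ≤ ρ then harmonicWeight ρ * m ρ else 0) ≤ τ)
    (hτ' : ∑ σ ∈ Finset.range L', (if K ≤ σ then harmonicWeight σ * m' σ else 0) ≤ τ')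
    {R : Bool → ℕ → ℝ}
    (hR : ∀ α ρ, R α ρ = G α false ρ 0 + G α true ρ 0 +
      ∑ σ ∈ Finset.range L', e' σ * (G α false ρ σ - G α true ρ σ)) :
    |R false 0 + R true 0 + ∑ ρ ∈ Finset.range L, e ρ * (R false ρ - R true ρ)| ≤
      36 * K ^ 2 * η + 12 * (τ + τ') := by
  have hK1 : (1 : ℝ) ≤ K := by exact_mod_cast hK
  have hnear2 : ∀ α β α' β', ∀ ρ < L, ρ < K → ∀ σ < L', σ < K →
      |G α β ρ σ - G α' β' ρ σ| ≤ 2 * η := by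
    intro α β α' β' ρ hρ hρK σ hσ hσK
    have h1 := hnear α β ρ hρ hρK σ hσ hσK
    have h2 := hnear α' β' ρ hρ hρK σ hσ hσK
    have := abs_sub (G α β ρ σ) (G α' β' ρ σ)
    linarith
  have hrow : ∀ α, |∑ σ ∈ Finset.range L', e' σ * (G α false 0 σ - G α true 0 σ)| ≤
      2 * K * (2 * η) + 2 * τ' := fun α =>
    abs_sum_weight_le (by linarith) he' (fun σ hσ hσK => hnear2 _ _ _ _ 0 hL hK σ hσ hσK)
      (fun σ hσ => hG' α 0 hL σ hσ) hτ'
  have hcol : ∀ β, |∑ ρ ∈ Finset.range L, e ρ * (G false β ρ 0 - G true β ρ 0)| ≤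
      2 * K * (2 * η) + 2 * τ := fun β =>
    abs_sum_weight_le (by linarith) he (fun ρ hρ hρK => hnear2 _ _ _ _ ρ hρ hρK 0 hL' hK)
      (fun ρ hρ => hG β ρ hρ 0 hL') hτ
  have htwo : ∀ c : ℕ → ℝ, ∀ K L : ℕ, ∑ ρ ∈ Finset.range L,
      (if K ≤ ρ then harmonicWeight ρ * (2 * c ρ) else 0) =
      2 * ∑ ρ ∈ Finset.range L, (if K ≤ ρ then harmonicWeight ρ * c ρ else 0) := by
    intro c K L
    rw [Finset.mul_sum]
    refine Finset.sum_congr rfl fun ρ _ => ?_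
    split_ifs <;> ring
  let D : ℕ → ℕ → ℝ := fun ρ σ =>
    (G false false ρ σ - G true false ρ σ) - (G false true ρ σ - G true true ρ σ)
  have hmix : |∑ ρ ∈ Finset.range L, ∑ σ ∈ Finset.range L', e ρ * e' σ * D ρ σ| ≤
      4 * K ^ 2 * (4 * η) + 4 * (2 * τ) + 4 * (2 * τ') := by
    refine abs_sum_sum_weight_le (m := fun ρ => 2 * m ρ) (m' := fun σ => 2 * m' σ) (by linarith)
      he he' (fun ρ => mul_nonneg two_pos.le (hm ρ)) (fun σ => mul_nonneg two_pos.le (hm' σ))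
      ?_ ?_ ?_ ?_ ?_
    · intro ρ hρ hρK σ hσ hσK
      have h1 := hnear2 false false true false ρ hρ hρK σ hσ hσK
      have h2 := hnear2 false true true true ρ hρ hρK σ hσ hσK
      exact (abs_sub _ _).trans (by linarith)
    · intro ρ hρ σ hσ
      have h1 := hG false ρ hρ σ hσ
      have h2 := hG true ρ hρ σ hσ
      exact (abs_sub _ _).trans (by linarith)
    · intro ρ hρ σ hσ
      have h1 := hG' false ρ hρ σ hσ
      have h2 := hG' true ρ hρ σ hσ
      -- The mixed difference is symmetric in the order of differencing, so it is also controlled by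
      -- increments in the second variable.
      have h3 : D ρ σ = (G false false ρ σ - G false true ρ σ) -
        (G true false ρ σ - G true true ρ σ) := by simp only [D]; ring
      rw [h3]
      exact (abs_sub _ _).trans (by linarith)
    · rw [htwo]; linarith
    · rw [htwo]; linarith
  have hexp : ∑ ρ ∈ Finset.range L, e ρ * (R false ρ - R true ρ) =
      ∑ ρ ∈ Finset.range L, e ρ * (G false false ρ 0 - G true false ρ 0) +
      ∑ ρ ∈ Finset.range L, e ρ * (G false true ρ 0 - G true true ρ 0) +
      ∑ ρ ∈ Finset.range L, ∑ σ ∈ Finset.range L', e ρ * e' σ * D ρ σ := by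
    rw [← Finset.sum_add_distrib, ← Finset.sum_add_distrib]
    refine Finset.sum_congr rfl fun ρ _ => ?_
    have : ∑ σ ∈ Finset.range L', e ρ * e' σ * D ρ σ =
        e ρ * (∑ σ ∈ Finset.range L', e' σ * (G false false ρ σ - G false true ρ σ) -
          ∑ σ ∈ Finset.range L', e' σ * (G true false ρ σ - G true true ρ σ)) := by
      rw [← Finset.sum_sub_distrib, Finset.mul_sum]
      refine Finset.sum_congr rfl fun σ _ => ?_
      simp only [D]
      ring
    rw [this, hR, hR]
    ring
  rw [hexp, hR, hR]
  have a1 := hnear false false 0 hL hK 0 hL' hK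
  have a2 := hnear false true 0 hL hK 0 hL' hK
  have a3 := hnear true false 0 hL hK 0 hL' hK
  have a4 := hnear true true 0 hL hK 0 hL' hK
  have b1 := hrow false
  have b2 := hrow true
  have c1 := hcol false
  have c2 := hcol true
  -- The continuity part totals `4η + 16Kη + 16K²η`, from central values, single and mixed
  -- differences; `K ≥ 1` absorbs it into `36K²η`.
  have hKη : K * η ≤ K ^ 2 * η := by
    have : (K : ℝ) ≤ K ^ 2 := by nlinarith
    gcongr
  have hη1 : η ≤ K ^ 2 * η := le_mul_of_one_le_left hη (one_le_pow₀ hK1)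
  rw [abs_le] at a1 a2 a3 a4 b1 b2 c1 c2 hmix ⊢
  obtain ⟨a1l, a1r⟩ := a1
  obtain ⟨a2l, a2r⟩ := a2
  obtain ⟨a3l, a3r⟩ := a3
  obtain ⟨a4l, a4r⟩ := a4
  obtain ⟨b1l, b1r⟩ := b1
  obtain ⟨b2l, b2r⟩ := b2
  obtain ⟨c1l, c1r⟩ := c1
  obtain ⟨c2l, c2r⟩ := c2
  obtain ⟨dl, dr⟩ := hmix
  constructor <;> linarith

/-! ### The estimate for `f` on a shifted grid -/

/-- Xor with `ρ < 2 ^ k` changes only the lowest `k` digits of the index, hence nothing at levels up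
to `A - k`. -/
lemma cell_eq_of_xor_lt {A p k ρ : ℕ} {x s : ℝ} (hA : p + k ≤ A)
    (h : cell A s = ρ ^^^ cell A x) (hρ : ρ < 2 ^ k) : cell p s = cell p x := by
  obtain ⟨q, rfl⟩ := Nat.exists_eq_add_of_le' ((Nat.le_add_left k p).trans hA)
  refine cell_eq_of_le (q := q) (by omega) ?_
  rw [← cell_div q k, ← cell_div q k x, h, Nat.xor_div_two_pow, Nat.div_eq_of_lt hρ, Nat.zero_xor]

/-- The increments of `f` over the sibling halves of dyadic intervals, shifted by `u` and listed
by dyadic distance from the interval of index `c`, have a majorant with small weighted tail. -/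
lemma exists_sibling_majorant (f : ℝ → ℝ → ℝ) {A c K : ℕ} (hc : c < 2 ^ A) {u : ℝ}
    (hu : u ∈ Set.Ico (0 : ℝ) ((2 ^ (A + 1))⁻¹)) {T : Finset ℝ} (hT : T.Nonempty)
    (hTI : ∀ y ∈ T, y ∈ unitI) {τ : ℝ} (hτ : 0 ≤ τ)
    (htail : 3 * ∑' n, vSharpOne f (n + K + 1) * ENNReal.ofReal (logWeight (n + K)) ≤
      ENNReal.ofReal τ) :
    ∃ m : ℕ → ℝ, (∀ ρ, 0 ≤ m ρ) ∧
      (∀ ρ, ∀ y ∈ T, |f (((2 * (ρ ^^^ c) + 1 : ℕ) : ℝ) / 2 ^ (A + 1) + u) y -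
        f (((2 * (ρ ^^^ c) : ℕ) : ℝ) / 2 ^ (A + 1) + u) y| ≤ m ρ) ∧
      ∑ ρ ∈ Finset.range (2 ^ A), (if K ≤ ρ then harmonicWeight ρ * m ρ else 0) ≤ τ := by
  let a : ℕ → ℝ := fun ρ => ((2 * (ρ ^^^ c) : ℕ) : ℝ) / 2 ^ (A + 1) + u
  let b : ℕ → ℝ := fun ρ => ((2 * (ρ ^^^ c) + 1 : ℕ) : ℝ) / 2 ^ (A + 1) + u
  have hab : ∀ ρ < 2 ^ A, a ρ ∈ unitI ∧ b ρ ∈ unitI ∧ a ρ < b ρ := by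
    intro ρ hρ
    have hlt : ρ ^^^ c < 2 ^ A := Nat.xor_lt_two_pow hρ hc
    refine ⟨grid_mem_unitI (by rw [pow_succ']; omega) hu,
      grid_mem_unitI (by rw [pow_succ']; omega) hu, ?_⟩
    simp only [a, b]
    gcongr
    omega
  -- Shifted back by `u`, each interval lies in one cell of level `A + 1`, and distinct `ρ` give
  -- distinct cells.
  have key : ∀ ρ, ∀ z ∈ Set.Ioo (a ρ) (b ρ), cell (A + 1) (z - u) = 2 * (ρ ^^^ c) := by
    intro ρ z hz
    have := cell_grid (a := A + 1) (i := 2 * (ρ ^^^ c))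
      (u := z - u - ((2 * (ρ ^^^ c) : ℕ) : ℝ) / 2 ^ (A + 1)) ⟨by linarith [hz.1], by
        have := hz.2
        simp only [b] at this
        rw [Nat.cast_add (2 * (ρ ^^^ c)), Nat.cast_one, add_div, one_div] at this
        linarith⟩
    rwa [add_sub_cancel] at this
  have hd : ∀ ρ < 2 ^ A, ∀ σ < 2 ^ A, ρ ≠ σ →
      Disjoint (Set.Ioo (a ρ) (b ρ)) (Set.Ioo (a σ) (b σ)) := by
    intro ρ _ σ _ hne
    refine Set.disjoint_left.2 fun z hz hz' => hne ?_
    have h := (key _ z hz).symm.trans (key _ z hz')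
    have h' : ρ ^^^ c = σ ^^^ c := by omega
    have h'' := congrArg (· ^^^ c) h'
    simpa only [Nat.xor_assoc, Nat.xor_self, Nat.xor_zero] using h''
  obtain ⟨m, hm, hmT, hV⟩ := exists_increment_majorant f hab hd hT hTI
  exact ⟨m, hm, hmT, sum_harmonicWeight_le_of_tail_le hm hV hτ htail⟩

/-- Pointwise estimate for the discretised double partial sum on a shifted dyadic grid. -/
lemma abs_grid_sum_sub_le {f : ℝ → ℝ → ℝ} {x y η τ : ℝ} (hx : x ∈ unitI) (hy : y ∈ unitI)
    (hη : 0 ≤ η) (hτ : 0 ≤ τ) {p K A B M N : ℕ} (hK : 0 < K)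
    (hf : ∀ s ∈ unitI, ∀ t ∈ unitI, s ∉ exceptional x → t ∉ exceptional y →
      cell p s = cell p x → cell p t = cell p y → |f s t - f x y| ≤ η)
    (h₁ : 3 * ∑' n, vSharpOne f (n + K + 1) * ENNReal.ofReal (logWeight (n + K)) ≤
      ENNReal.ofReal τ)
    (h₂ : 3 * ∑' n, vSharpTwo f (n + K + 1) * ENNReal.ofReal (logWeight (n + K)) ≤
      ENNReal.ofReal τ)
    (hA : p + K ≤ A) (hB : p + K ≤ B) (hM : M < 2 ^ A) (hN : N < 2 ^ B) {u v : ℝ}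
    (hu : u ∈ Set.Ico (0 : ℝ) ((2 ^ (A + 1))⁻¹)) (hv : v ∈ Set.Ico (0 : ℝ) ((2 ^ (B + 1))⁻¹))
    (hux : ∀ i : ℕ, (i : ℝ) / 2 ^ (A + 1) + u ∉ exceptional x)
    (hvy : ∀ j : ℕ, (j : ℝ) / 2 ^ (B + 1) + v ∉ exceptional y) :
    |∑ i ∈ Finset.range (2 ^ (A + 1)), walshKernel (2 ^ A + M) x ((i : ℝ) / 2 ^ (A + 1)) *
        ∑ j ∈ Finset.range (2 ^ (B + 1)), walshKernel (2 ^ B + N) y ((j : ℝ) / 2 ^ (B + 1)) *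
          f ((i : ℝ) / 2 ^ (A + 1) + u) ((j : ℝ) / 2 ^ (B + 1) + v) -
        2 ^ (A + 1) * 2 ^ (B + 1) * f x y| ≤
      2 ^ A * 2 ^ B * (36 * K ^ 2 * η + 24 * τ) := by
  obtain ⟨e, he, hE⟩ := exists_kernel_weights hM hx
  obtain ⟨e', he', hE'⟩ := exists_kernel_weights hN hy
  set c := cell A x with hc
  set d := cell B y with hd
  have hcA : c < 2 ^ A := cell_lt hx A
  have hdB : d < 2 ^ B := cell_lt hy B
  let S : ℕ → ℝ := fun i => (i : ℝ) / 2 ^ (A + 1) + u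
  let T : ℕ → ℝ := fun j => (j : ℝ) / 2 ^ (B + 1) + v
  have hSI : ∀ i < 2 ^ (A + 1), S i ∈ unitI := fun i hi => grid_mem_unitI hi hu
  have hTI : ∀ j < 2 ^ (B + 1), T j ∈ unitI := fun j hj => grid_mem_unitI hj hv
  have hidx : ∀ {A c ρ : ℕ} (α : Bool), c < 2 ^ A → ρ < 2 ^ A →
      2 * (ρ ^^^ c) + α.toNat < 2 ^ (A + 1) := by
    intro A c ρ α hc hρ
    have := Nat.xor_lt_two_pow hρ hc
    have := α.toNat_lt
    rw [pow_succ']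
    omega
  have hcell : ∀ {A c ρ : ℕ} (α : Bool) {u : ℝ}, u ∈ Set.Ico (0 : ℝ) ((2 ^ (A + 1))⁻¹) →
      cell A (((2 * (ρ ^^^ c) + α.toNat : ℕ) : ℝ) / 2 ^ (A + 1) + u) = ρ ^^^ c := by
    intro A c ρ α u hu
    have := α.toNat_lt
    rw [← cell_div A 1, cell_grid hu]
    omega
  obtain ⟨m, hm, hmT, hmτ⟩ := exists_sibling_majorant f hcA hu
    (T := (Finset.range (2 ^ (B + 1))).image T) (by simp) (by
      intro t ht
      obtain ⟨j, hj, rfl⟩ := Finset.mem_image.1 ht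
      exact hTI j (Finset.mem_range.1 hj)) hτ h₁
  -- With the variables swapped, `vSharpOne` unfolds to `vSharpTwo f`, so `h₂` serves as the tail
  -- bound.
  obtain ⟨m', hm', hmT', hmτ'⟩ := exists_sibling_majorant (fun s t => f t s) hdB hv
    (T := (Finset.range (2 ^ (A + 1))).image S) (by simp) (by
      intro s hs
      obtain ⟨i, hi, rfl⟩ := Finset.mem_image.1 hs
      exact hSI i (Finset.mem_range.1 hi)) hτ h₂
  let F : ℕ → ℕ → ℝ := fun i j => f (S i) (T j) - f x y
  let G : Bool → Bool → ℕ → ℕ → ℝ := fun α β ρ σ =>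
    F (2 * (ρ ^^^ c) + α.toNat) (2 * (σ ^^^ d) + β.toNat)
  have hKK : K < 2 ^ K := Nat.lt_two_pow_self
  have hQ := abs_weighted_array_le (G := G) (R := fun α ρ => G α false ρ 0 + G α true ρ 0 +
      ∑ σ ∈ Finset.range (2 ^ B), e' σ * (G α false ρ σ - G α true ρ σ))
    (Nat.two_pow_pos A) (Nat.two_pow_pos B) hK hη he he' hm hm' (by
      intro α β ρ hρ hρK σ hσ hσK
      exact hf _ (hSI _ (hidx α hcA hρ)) _ (hTI _ (hidx β hdB hσ)) (hux _) (hvy _)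
        (cell_eq_of_xor_lt hA (hcell α hu) (hρK.trans hKK))
        (cell_eq_of_xor_lt hB (hcell β hv) (hσK.trans hKK))) (by
      intro β ρ hρ σ hσ
      have := hmT ρ (T (2 * (σ ^^^ d) + β.toNat)) (Finset.mem_image_of_mem _
        (Finset.mem_range.2 (hidx β hdB hσ)))
      rw [abs_sub_comm] at this
      simp only [G, F, sub_sub_sub_cancel_right]
      exact this) (by
      intro α ρ hρ σ hσ
      have := hmT' σ (S (2 * (ρ ^^^ c) + α.toNat)) (Finset.mem_image_of_mem _
        (Finset.mem_range.2 (hidx α hcA hρ)))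
      rw [abs_sub_comm] at this
      simp only [G, F, sub_sub_sub_cancel_right]
      exact this) hmτ hmτ' (fun _ _ => rfl)
  -- The discretised operator reproduces constants, since all sibling differences vanish; this
  -- allows `f x y` to be subtracted inside the sums.
  have hone : ∀ {A M : ℕ} {x : ℝ} {e : ℕ → ℝ} {c : ℕ},
      (∀ h : ℕ → ℝ, ∑ i ∈ Finset.range (2 ^ (A + 1)),
          walshKernel (2 ^ A + M) x ((i : ℝ) / 2 ^ (A + 1)) * h i =
        2 ^ A * (h (2 * c) + h (2 * c + 1) + ∑ ρ ∈ Finset.range (2 ^ A),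
            e ρ * (h (2 * (ρ ^^^ c)) - h (2 * (ρ ^^^ c) + 1)))) →
      ∀ r : ℝ, ∑ i ∈ Finset.range (2 ^ (A + 1)),
        walshKernel (2 ^ A + M) x ((i : ℝ) / 2 ^ (A + 1)) * r = 2 ^ (A + 1) * r := by
    intro A M x e c hE r
    have := hE fun _ => r
    simp only [sub_self, mul_zero, Finset.sum_const_zero, add_zero] at this
    rw [this]
    ring
  have hsub : ∑ i ∈ Finset.range (2 ^ (A + 1)), walshKernel (2 ^ A + M) x ((i : ℝ) / 2 ^ (A + 1)) *
        ∑ j ∈ Finset.range (2 ^ (B + 1)), walshKernel (2 ^ B + N) y ((j : ℝ) / 2 ^ (B + 1)) *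
          f ((i : ℝ) / 2 ^ (A + 1) + u) ((j : ℝ) / 2 ^ (B + 1) + v) -
        2 ^ (A + 1) * 2 ^ (B + 1) * f x y =
      ∑ i ∈ Finset.range (2 ^ (A + 1)), walshKernel (2 ^ A + M) x ((i : ℝ) / 2 ^ (A + 1)) *
        ∑ j ∈ Finset.range (2 ^ (B + 1)), walshKernel (2 ^ B + N) y ((j : ℝ) / 2 ^ (B + 1)) *
          F i j := by
    simp only [F, mul_sub, Finset.sum_sub_distrib]
    rw [hone hE' (f x y), hone hE (2 ^ (B + 1) * f x y), mul_assoc]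
  have hmain : ∑ i ∈ Finset.range (2 ^ (A + 1)),
      walshKernel (2 ^ A + M) x ((i : ℝ) / 2 ^ (A + 1)) *
        ∑ j ∈ Finset.range (2 ^ (B + 1)), walshKernel (2 ^ B + N) y ((j : ℝ) / 2 ^ (B + 1)) *
          F i j =
      2 ^ A * 2 ^ B * ((G false false 0 0 + G false true 0 0 +
        ∑ σ ∈ Finset.range (2 ^ B), e' σ * (G false false 0 σ - G false true 0 σ)) +
        (G true false 0 0 + G true true 0 0 +
        ∑ σ ∈ Finset.range (2 ^ B), e' σ * (G true false 0 σ - G true true 0 σ)) +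
        ∑ ρ ∈ Finset.range (2 ^ A), e ρ *
          ((G false false ρ 0 + G false true ρ 0 +
            ∑ σ ∈ Finset.range (2 ^ B), e' σ * (G false false ρ σ - G false true ρ σ)) -
          (G true false ρ 0 + G true true ρ 0 +
            ∑ σ ∈ Finset.range (2 ^ B), e' σ * (G true false ρ σ - G true true ρ σ)))) := by
    rw [hE]
    simp only [hE', G, Bool.toNat_false, Bool.toNat_true, add_zero, Nat.zero_xor]
    simp only [← mul_sub, mul_left_comm (e _), ← Finset.mul_sum]
    ring
  rw [hsub, hmain, abs_mul, abs_of_pos (by positivity : (0 : ℝ) < 2 ^ A * 2 ^ B)]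
  refine mul_le_mul_of_nonneg_left (hQ.trans (by linarith)) (by positivity)

/-! ### Integration over the shifts and conclusion -/

lemma ae_forall_grid_notMem (C : Set ℝ) (hC : C.Countable) (a : ℕ) :
    ∀ᵐ u : ℝ, ∀ i : ℕ, (i : ℝ) / 2 ^ a + u ∉ C := by
  rw [ae_all_iff]
  intro i
  exact (measurePreserving_add_left volume ((i : ℝ) / 2 ^ a)).quasiMeasurePreserving.ae
    (hC.ae_notMem _)

lemma abs_walshPartialSum_sub_le {f : ℝ → ℝ → ℝ}
    (hfi : IntegrableOn (fun p : ℝ × ℝ => f p.1 p.2) unitSq)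
    {x y η τ : ℝ} (hx : x ∈ unitI) (hy : y ∈ unitI)
    (hη : 0 ≤ η) (hτ : 0 ≤ τ) {p K A B M N : ℕ} (hK : 0 < K)
    (hf : ∀ s ∈ unitI, ∀ t ∈ unitI, s ∉ exceptional x → t ∉ exceptional y →
      cell p s = cell p x → cell p t = cell p y → |f s t - f x y| ≤ η)
    (h₁ : 3 * ∑' n, vSharpOne f (n + K + 1) * ENNReal.ofReal (logWeight (n + K)) ≤
      ENNReal.ofReal τ)
    (h₂ : 3 * ∑' n, vSharpTwo f (n + K + 1) * ENNReal.ofReal (logWeight (n + K)) ≤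
      ENNReal.ofReal τ)
    (hA : p + K ≤ A) (hB : p + K ≤ B) (hM : M < 2 ^ A) (hN : N < 2 ^ B) :
    |walshPartialSum f (2 ^ A + M) (2 ^ B + N) x y - f x y| ≤
      (36 * K ^ 2 * η + 24 * τ) / 4 := by
  have hle : ∀ {A M : ℕ}, M < 2 ^ A → 2 ^ A + M ≤ 2 ^ (A + 1) := fun h => by
    rw [pow_succ]; omega
  obtain ⟨hint, heq⟩ := walshPartialSum_eq_integral_grid hfi (hle hM) (hle hN) x y
  have hvol : volume.real (cornerRect (A + 1) (B + 1)) = (2 ^ (A + 1))⁻¹ * (2 ^ (B + 1))⁻¹ := by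
    rw [Measure.real, volume_cornerRect, ENNReal.toReal_ofReal (by positivity)]
  have hfin : volume (cornerRect (A + 1) (B + 1)) < ∞ := by
    rw [volume_cornerRect]
    exact ENNReal.ofReal_lt_top
  have hconst : f x y = ∫ _ in cornerRect (A + 1) (B + 1), 2 ^ (A + 1) * 2 ^ (B + 1) * f x y := by
    rw [setIntegral_const, hvol, smul_eq_mul]
    field_simp
  have hae : ∀ᵐ q : ℝ × ℝ, (∀ i : ℕ, (i : ℝ) / 2 ^ (A + 1) + q.1 ∉ exceptional x) ∧
      ∀ j : ℕ, (j : ℝ) / 2 ^ (B + 1) + q.2 ∉ exceptional y := by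
    rw [Measure.volume_eq_prod]
    exact (Measure.quasiMeasurePreserving_fst.ae
      (ae_forall_grid_notMem _ (countable_exceptional x) _)).and
      (Measure.quasiMeasurePreserving_snd.ae
        (ae_forall_grid_notMem _ (countable_exceptional y) _))
  rw [heq]
  conv_lhs => rw [hconst]
  rw [← integral_sub hint (integrableOn_const hfin.ne), ← Real.norm_eq_abs]
  refine (norm_setIntegral_le_of_norm_le_const_ae' (C := 2 ^ A * 2 ^ B * (36 * K ^ 2 * η + 24 * τ))
    hfin ?_).trans (le_of_eq ?_)
  · filter_upwards [hae] with q hq hqR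
    exact abs_grid_sum_sub_le hx hy hη hτ hK hf h₁ h₂ hA hB hM hN hqR.1 hqR.2 hq.1 hq.2
  -- The area `2^{-(A+1)} 2^{-(B+1)}` against the factor `2^A 2^B` leaves `1/4`.
  · rw [hvol, pow_succ, pow_succ]
    field_simp
    ring

/-- The first term of the series carries the positive weight `log 2`. -/
lemma vSharp_one_lt_top {V : ℕ → ℝ≥0∞}
    (h : ∑' n : ℕ, V (n + 1) * ENNReal.ofReal (logWeight n) < ∞) : V 1 < ∞ := by
  have h0 := (ENNReal.le_tsum (f := fun n => V (n + 1) * ENNReal.ofReal (logWeight n)) 0).trans_lt h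
  have hw : ENNReal.ofReal (logWeight 0) ≠ 0 := by
    rw [Ne, ENNReal.ofReal_eq_zero, not_le, logWeight]
    norm_num
    exact Real.log_pos one_lt_two
  rw [lt_top_iff_ne_top] at h0 ⊢
  intro hV
  exact h0 (by simp only [zero_add, hV, ENNReal.top_mul hw])

/-- Going from `(0, 0)` to any point along the two axis directions costs one increment in each
variable, so `f` is bounded on a set of finite measure. -/
lemma integrableOn_of_vSharp {f : ℝ → ℝ → ℝ}
    (hf : AEMeasurable (fun p : ℝ × ℝ => f p.1 p.2) (volume.restrict unitSq))
    (h₁ : vSharpOne f 1 < ∞) (h₂ : vSharpTwo f 1 < ∞) :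
    IntegrableOn (fun p : ℝ × ℝ => f p.1 p.2) unitSq := by
  have hfin : volume unitSq < ∞ := by
    rw [unitSq, unitI, Measure.volume_eq_prod, Measure.prod_prod]
    simp
  have h0 : (0 : ℝ) ∈ unitI := ⟨le_rfl, one_pos⟩
  have : IsFiniteMeasure (volume.restrict unitSq) := ⟨by rwa [Measure.restrict_apply_univ]⟩
  refine Integrable.of_bound hf.aestronglyMeasurable
    (|f 0 0| + (vSharpOne f 1).toReal + (vSharpTwo f 1).toReal) ?_
  filter_upwards [ae_restrict_mem measurableSet_unitSq] with p hp
  have h3 := (ENNReal.ofReal_le_iff_le_toReal h₁.ne).1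
    (ofReal_abs_sub_le_vSharpOne f h0 hp.1 hp.2)
  have h4 := (ENNReal.ofReal_le_iff_le_toReal h₂.ne).1
    (ofReal_abs_sub_le_vSharpOne (fun s t => f t s) h0 hp.2 h0)
  have h5 := abs_add_le (f p.1 p.2 - f 0 p.2 + (f 0 p.2 - f 0 0)) (f 0 0)
  have h6 := abs_add_le (f p.1 p.2 - f 0 p.2) (f 0 p.2 - f 0 0)
  rw [show f p.1 p.2 - f 0 p.2 + (f 0 p.2 - f 0 0) + f 0 0 = f p.1 p.2 by ring] at h5
  rw [Real.norm_eq_abs]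
  linarith

lemma eventually_tail_le {V : ℕ → ℝ≥0∞}
    (h : ∑' n : ℕ, V (n + 1) * ENNReal.ofReal (logWeight n) < ∞) {τ : ℝ} (hτ : 0 < τ) :
    ∀ᶠ K in Filter.atTop,
      3 * ∑' n, V (n + K + 1) * ENNReal.ofReal (logWeight (n + K)) ≤ ENNReal.ofReal τ := by
  have ht := ENNReal.tendsto_sum_nat_add (fun n => V (n + 1) * ENNReal.ofReal (logWeight n)) h.ne
  filter_upwards [ht.eventually (gt_mem_nhds (ENNReal.ofReal_pos.2 (by positivity : 0 < τ / 3)))]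
    with K hK
  calc _ ≤ 3 * ENNReal.ofReal (τ / 3) := by gcongr
    _ = ENNReal.ofReal τ := by
      rw [← ENNReal.ofReal_ofNat, ← ENNReal.ofReal_mul (by norm_num)]
      congr 1
      ring

lemma exists_two_pow_add_of_le {P M : ℕ} (h : 2 ^ P ≤ M) :
    ∃ A M', P ≤ A ∧ M = 2 ^ A + M' ∧ M' < 2 ^ A := by
  obtain ⟨A, M', rfl, hM'⟩ := exists_two_pow_add ((Nat.two_pow_pos P).trans_le h)
  refine ⟨A, M', ?_, rfl, hM'⟩
  by_contra hlt
  have := Nat.pow_le_pow_right (n := 2) (by norm_num) (not_le.1 hlt)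
  rw [Nat.succ_eq_add_one, pow_succ] at this
  omega

end WalshFourier

theorem mainTheorem5 (f : ℝ → ℝ → ℝ)
    (hf : AEMeasurable (fun p : ℝ × ℝ => f p.1 p.2) (volume.restrict WalshFourier.unitSq))
    (h₁ : ∑' n : ℕ, WalshFourier.vSharpOne f (n + 1) *
      ENNReal.ofReal (Real.log ((n : ℝ) + 1 + 1) / ((n : ℝ) + 1) ^ 2) < ∞)
    (h₂ : ∑' n : ℕ, WalshFourier.vSharpTwo f (n + 1) *
      ENNReal.ofReal (Real.log ((n : ℝ) + 1 + 1) / ((n : ℝ) + 1) ^ 2) < ∞) :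
    IntegrableOn (fun p : ℝ × ℝ => f p.1 p.2) WalshFourier.unitSq ∧
      ∀ x ∈ WalshFourier.unitI, ∀ y ∈ WalshFourier.unitI,
        WalshFourier.DyadicContinuousAt f x y →
          Filter.Tendsto
            (fun p : ℕ × ℕ => WalshFourier.walshPartialSum f p.1 p.2 x y)
            (Filter.atTop ×ˢ Filter.atTop) (𝓝 (f x y)) := by
  have hint := WalshFourier.integrableOn_of_vSharp hf (WalshFourier.vSharp_one_lt_top h₁)
    (WalshFourier.vSharp_one_lt_top h₂)
  refine ⟨hint, fun x hx y hy hcont => ?_⟩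
  rw [Filter.prod_atTop_atTop_eq, Metric.tendsto_atTop]
  intro ε hε
  -- With `τ = ε/48` and, once `K` is fixed, `η = ε/(72K²)`, the two parts of the bound are `ε/2`
  -- each before division by `4`.
  obtain ⟨K, hK₁, hK₂, hK⟩ := ((WalshFourier.eventually_tail_le h₁ (τ := ε / 48) (by positivity)).and
    ((WalshFourier.eventually_tail_le h₂ (τ := ε / 48) (by positivity)).and
      (Filter.eventually_gt_atTop 0))).exists
  have hK0 : (0 : ℝ) < K := by exact_mod_cast hK
  obtain ⟨p, hp⟩ := hcont.exists_cell (η := ε / (72 * K ^ 2)) (by positivity)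
  refine ⟨(2 ^ (p + K), 2 ^ (p + K)), fun q hq => ?_⟩
  obtain ⟨A, M, hA, hqA, hM⟩ := WalshFourier.exists_two_pow_add_of_le hq.1
  obtain ⟨B, N, hB, hqB, hN⟩ := WalshFourier.exists_two_pow_add_of_le hq.2
  rw [hqA, hqB, Real.dist_eq]
  refine (WalshFourier.abs_walshPartialSum_sub_le hint hx hy (by positivity)
    (by positivity : 0 ≤ ε / 48) hK hp hK₁ hK₂ hA hB hM hN).trans_lt ?_
  have : 36 * (K : ℝ) ^ 2 * (ε / (72 * K ^ 2)) = ε / 2 := by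
    field_simp
    norm_num
  rw [this]
  linarith
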